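/- **Setting.** Let $\mathcal M=(\mathcal S,\mathcal A,\mathbb P,r,H,d_1)$ be an episodic time-inhomogeneous MDP with $H\ge 1$, arbitrary state and action sets, discrete laws $d_1$ and $\mathbb P_h(\cdot|s,a)$, and known deterministic rewards $r_h:\mathcal S\times\mathcal A\to[0,1]$. Policies are randomized and Markov, $v^\pi$ is the expected total reward of $\pi$, $v^*=\sup_\pi v^\pi$, $\mathrm{SubOpt}(\pi)=v^*-v^\pi$, and $d^\pi_h(s,a)$ is the probability that $\pi$ visits $(s,a)$ at stage $h$. The MDP is a *linear mixture MDP*: there are a known map $\phi(s'|s,a)\in\mathbb R^d$ and unknown $w_h^*\in\mathbb R^d$, $\|w^*_h\|_2\le C_w$, with $\mathbb P_h(s'|s,a)=\langle\phi(s'|s,a),w^*_h\rangle$ for all $(s,a,s',h)$, and $\|\phi_V(s,a)\|_2\le1$ for all $(s,a)$ and all $V:\mathcal S\to[0,1]$, where $\phi_V(s,a)=\sum_{s'}\phi(s'|s,a)V(s')$. **Data.** The data $\mathcal D$ are $K\ge1$ episodes $(s^t_h,a^t_h,r^t_h)_{h\in[H]}$, $t\in[K]$. Given the first $t-1$ episodes,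 episode $t$ is generated in $\mathcal M$ by a behaviour policy $\mu^t$, which may depend on those episodes (a single fixed $\mu$ is a special case). The action supports $\mathrm{supp}\,\mu^t_h(\cdot|s)=:B_h(s)$ at the states $s$ that some policy can reach at stage $h$ are the same for all possible $\mu^t$ and known to the learner; $\Pi_h(\mu)$ is the set of stage-$h$ policies whose support at each such $s$ lies in $B_h(s)$. Assume * (optimal-policy concentrability) there is an optimal policy $\pi^*$ such that $d_h^{\pi^*}(s,a)>0$ implies $d_h^{\mu^t}(s,a)>0$, for all $h,s,a$ and all $\mu^t$ that occur with positive probability, $t\le K$; * (density lower bound) for every $h$, $\kappa_h^{-1}:=\inf d_h^{\mu^t}(s,a)>0$, the infimum over all $t\le K$, all $\mu^t$ that occur with positive probability and all $(s,a)$ with $d_h^{\mu^t}(s,a)>0$. Put $\kappa=\sum_{h=1}^H\kappa_h$. **BCP-VTR.** For $k=1,\dots,K+1$ put $\hat V^k_{H+1}=0$ and, for $h=H,\dots,1$, with $\phi^k_h:=\phi_{\hat V^k_{h+1}}$, $$\Sigma^k_h=\lambda I+\sum_{t<k}\phi^k_h(s^t_h,a^t_h)\phi^k_h(s^t_h,a^t_h)^\top,\qquad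 \hat w^k_h=(\Sigma^k_h)^{-1}\sum_{t<k}\phi^k_h(s^t_h,a^t_h)\hat V^k_{h+1}(s^t_{h+1}),$$ $$\hat Q^k_h=\max\Big\{0,\min\big\{r_h+\langle\phi^k_h,\hat w^k_h\rangle-\beta_k\|\phi^k_h\|_{(\Sigma^k_h)^{-1}},\,H-h+1\big\}\Big\},$$ $$\hat\pi^k_h\in\arg\max_{\pi_h\in\Pi_h(\mu)}\langle\hat Q^k_h,\pi_h\rangle,\qquad \hat V^k_h=\langle\hat Q^k_h,\hat\pi^k_h\rangle,$$ where $\lambda=1$, $\delta=1/K$ and $\beta_k=H\sqrt{d\log\frac{H+kH^3/\lambda}{\delta}}+\sqrt\lambda\,C_w$. The mixture policy $\hat\pi^{mix}$ executes a uniformly drawn member of $\hat\pi^1,\dots,\hat\pi^K$, so that $\mathbb E[\mathrm{SubOpt}(\hat\pi^{mix})\mid\mathcal D]=\frac1K\sum_{k=1}^K\mathrm{SubOpt}(\hat\pi^k)$; the last iterate is $\hat\pi^{last}=\hat\pi^{K+1}$. **Theorem.** There are universal constants $C>0$ and $p\in\mathbb N$ such that in every such situation, with $$\varepsilon:=C\,(1+C_w)\,\frac{\kappa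 H d}{\sqrt K}\,\big(1+\log(dHK)\big)^p,$$ with probability at least $1-C/K$ over $\mathcal D$, $$\mathbb E\big[\mathrm{SubOpt}(\hat\pi^{mix})\mid\mathcal D\big]\vee\mathrm{SubOpt}(\hat\pi^{last})\le\varepsilon ,$$ and moreover, in expectation over $\mathcal D$ as well, $$\mathbb E\big[\mathrm{SubOpt}(\hat\pi^{mix})\big]\vee\mathbb E\big[\mathrm{SubOpt}(\hat\pi^{last})\big]\le\varepsilon .$$ -/

import Mathlib

open scoped Matrix

noncomputable section

namespace OfflineRL

universe u v w

/-- Expectation of a real function under a discrete distribution. -/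
def pexp {X : Type w} (p : PMF X) (f : X → ℝ) : ℝ := ∑' x, (p x).toReal * f x

/-- Probability of an event under a discrete distribution. -/
def prob {X : Type w} (p : PMF X) (E : Set X) : ℝ := (p.toOuterMeasure E).toReal

/-- An episodic time-inhomogeneous MDP with discrete transition laws and deterministic rewards in
`[0, 1]`. Stages are numbered `0, …, H - 1`; data at stages `≥ H` are irrelevant. -/
structure MDP (S : Type u) (A : Type v) where
  H : ℕ
  init : PMF S
  P : ℕ → S → A → PMF S
  r : ℕ → S → A → ℝ
  r_nonneg : ∀ h s a, 0 ≤ r h s a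
  r_le_one : ∀ h s a, r h s a ≤ 1

/-- A (randomized, Markov, time-inhomogeneous) policy. -/
abbrev Policy (S : Type u) (A : Type v) := ℕ → S → PMF A

variable {S : Type u} {A : Type v}

/-! ### Values, optimality, occupancies -/

/-- Expected reward collected by `π` in the `j` stages starting with stage `h` in state `s`. -/
def valueFrom (M : MDP S A) (π : Policy S A) : ℕ → ℕ → S → ℝ
  | 0, _, _ => 0
  | j + 1, h, s =>
      pexp (π h s) fun a => M.r h s a + pexp (M.P h s a) (valueFrom M π j (h + 1))

/-- The value `v^π = 𝔼_{s ∼ init} V₁^π(s)`. -/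
def value (M : MDP S A) (π : Policy S A) : ℝ := pexp M.init (valueFrom M π M.H 0)

def IsOptimal (M : MDP S A) (π : Policy S A) : Prop := ∀ π' : Policy S A, value M π' ≤ value M π

/-- The optimal value `v^*` (the rewards are bounded, so the supremum is over a bounded set). -/
def optValue (M : MDP S A) : ℝ := ⨆ π : Policy S A, value M π

def subOpt (M : MDP S A) (π : Policy S A) : ℝ := optValue M - value M π

/-- The law of the state at stage `h` under `π`. -/
def stateOcc (M : MDP S A) (π : Policy S A) : ℕ → PMF S
  | 0 => M.init
  | h + 1 => (stateOcc M π h).bind fun s => (π h s).bind fun a => M.P h s a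

/-- The state-action visitation mass `d_h^π(s, a) = d_h^π(s) π_h(a | s)`. -/
def occ (M : MDP S A) (π : Policy S A) (h : ℕ) (s : S) (a : A) : ℝ :=
  (stateOcc M π h s).toReal * (π h s a).toReal

/-- The states that some policy visits at stage `h` with positive probability. -/
def feasibleStates (M : MDP S A) (h : ℕ) : Set S :=
  {s | ∃ π : Policy S A, s ∈ (stateOcc M π h).support}

/-! ### Offline data, possibly collected adaptively -/

/-- A trajectory `(s_h, a_h)_h`; the rewards are the known deterministic values `r_h(s_h, a_h)`. -/
abbrev Traj (M : MDP S A) := Fin M.H → S × A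

/-- The law of the next state after the first `n` state-action pairs. -/
def nextState (M : MDP S A) : (n : ℕ) → (Fin n → S × A) → PMF S
  | 0, _ => M.init
  | n + 1, τ => M.P n (τ (Fin.last n)).1 (τ (Fin.last n)).2

/-- The law of the first `n` state-action pairs of an episode under `π`. -/
def prefixLaw (M : MDP S A) (π : Policy S A) : (n : ℕ) → PMF (Fin n → S × A)
  | 0 => PMF.pure Fin.elim0
  | n + 1 => (prefixLaw M π n).bind fun τ => (nextState M n τ).bind fun s =>
      (π n s).bind fun a => PMF.pure (Fin.snoc (α := fun _ => S × A) τ (s, a))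

def trajLaw (M : MDP S A) (π : Policy S A) : PMF (Traj M) := prefixLaw M π M.H

/-- A data collector: the behaviour policy of each episode may depend on all earlier episodes.
A collector that ignores its second argument gives independent episodes. -/
abbrev Collector (M : MDP S A) := (n : ℕ) → (Fin n → Traj M) → Policy S A

/-- The law of the first `n` episodes generated by the collector `μ`. -/
def dataLaw (M : MDP S A) (μ : Collector M) : (n : ℕ) → PMF (Fin n → Traj M)
  | 0 => PMF.pure Fin.elim0
  | n + 1 => (dataLaw M μ n).bind fun D => (trajLaw M (μ n D)).bind fun τ =>
      PMF.pure (Fin.snoc (α := fun _ => Traj M) D τ)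

/-- The first `n` of `K` episodes. -/
def firstEpisodes {M : MDP S A} {K : ℕ} (D : Fin K → Traj M) (n : ℕ) (hn : n ≤ K) :
    Fin n → Traj M := fun i => D (Fin.castLE hn i)

/-- `B h s` is the (known) action support of the behaviour at the feasible state `s` of stage `h`:
every behaviour policy that is used in the `K` episodes has it. -/
def HasSupport (M : MDP S A) (μ : Collector M) (K : ℕ) (B : ℕ → S → Set A) : Prop :=
  ∀ n < K, ∀ D ∈ (dataLaw M μ n).support, ∀ h < M.H, ∀ s ∈ feasibleStates M h,
    (μ n D h s).support = B h s

/-- Optimal-policy concentrability. -/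
def OPC (M : MDP S A) (μ : Collector M) (K : ℕ) : Prop :=
  ∃ πs : Policy S A, IsOptimal M πs ∧
    ∀ n < K, ∀ D ∈ (dataLaw M μ n).support, ∀ h < M.H, ∀ s a,
      0 < occ M πs h s a → 0 < occ M (μ n D) h s a

/-- `κ_h⁻¹`: the infimum of the positive visitation masses at stage `h` of the behaviour policies
that are used in the `K` episodes. -/
def kappaInv (M : MDP S A) (μ : Collector M) (K h : ℕ) : ℝ :=
  sInf {x | 0 < x ∧ ∃ n < K, ∃ D ∈ (dataLaw M μ n).support, ∃ s a, x = occ M (μ n D) h s a}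

/-- The density lower bound. -/
def DensityLowerBound (M : MDP S A) (μ : Collector M) (K : ℕ) : Prop :=
  ∀ h < M.H, 0 < kappaInv M μ K h

/-- `κ = ∑_h κ_h`. -/
def kappa (M : MDP S A) (μ : Collector M) (K : ℕ) : ℝ :=
  ∑ h ∈ Finset.range M.H, (kappaInv M μ K h)⁻¹

/-! ### Linear mixture MDPs -/

variable {d : ℕ}

/-- `φ_V(s, a) = ∑_{s'} φ(s' | s, a) V(s')`, where `φ(s' | s, a)` is written `φ s a s'`. -/
def featV (φ : S → A → S → EuclideanSpace ℝ (Fin d)) (V : S → ℝ) (s : S) (a : A) :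
    EuclideanSpace ℝ (Fin d) := ∑' s', V s' • φ s a s'

/-- Linear mixture MDP. The last condition, for indicators of finite sets, forces the series
that define `φ_V` to converge absolutely for bounded `V`. -/
structure IsLinearMixture (M : MDP S A) (φ : S → A → S → EuclideanSpace ℝ (Fin d)) (Cw : ℝ) :
    Prop where
  transition : ∃ w : ℕ → EuclideanSpace ℝ (Fin d), ∀ h < M.H, ‖w h‖ ≤ Cw ∧
    ∀ s a s', (M.P h s a s').toReal = inner ℝ (φ s a s') (w h)
  feature : ∀ V : S → ℝ, (∀ s, 0 ≤ V s ∧ V s ≤ 1) → ∀ s a, ‖featV φ V s a‖ ≤ 1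

/-! ### The algorithm BCP-VTR -/

section Algorithm

variable (M : MDP S A) (φ : S → A → S → EuclideanSpace ℝ (Fin d)) (lam : ℝ)
  {n : ℕ} (D : Fin n → Traj M)

/-- `Σ_h = ∑_t φ_V(s_h^t, a_h^t) φ_V(s_h^t, a_h^t)ᵀ + λ I`, where `V` is the estimate for the
next stage. -/
def gram (h : Fin M.H) (V : S → ℝ) : Matrix (Fin d) (Fin d) ℝ :=
  ∑ t, Matrix.vecMulVec (featV φ V (D t h).1 (D t h).2).ofLp
    (featV φ V (D t h).1 (D t h).2).ofLp + lam • (1 : Matrix (Fin d) (Fin d) ℝ)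

/-- The regression target `V(s_{h+1}^t)`; after the last stage it is `0`. -/
def target (h : Fin M.H) (V : S → ℝ) (t : Fin n) : ℝ :=
  if hh : (h : ℕ) + 1 < M.H then V (D t ⟨(h : ℕ) + 1, hh⟩).1 else 0

/-- `ŵ_h = Σ_h⁻¹ ∑_t φ_V(s_h^t, a_h^t) V(s_{h+1}^t)`. -/
def wHat (h : Fin M.H) (V : S → ℝ) : Fin d → ℝ :=
  (gram M φ lam D h V)⁻¹ *ᵥ
    ∑ t, target M D h V t • (featV φ V (D t h).1 (D t h).2).ofLp

/-- `b_h(s, a) = β ‖φ_V(s, a)‖_{Σ_h⁻¹}`. -/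
def bonus (β : ℝ) (h : Fin M.H) (V : S → ℝ) (s : S) (a : A) : ℝ :=
  β * √((featV φ V s a).ofLp ⬝ᵥ ((gram M φ lam D h V)⁻¹ *ᵥ (featV φ V s a).ofLp))

/-- `Q̂_h = min {r_h + ⟨φ_V, ŵ_h⟩ - b_h, number of remaining stages}⁺`. -/
def qHat (β : ℝ) (h : Fin M.H) (V : S → ℝ) (s : S) (a : A) : ℝ :=
  max (min (M.r h s a + (featV φ V s a).ofLp ⬝ᵥ wHat M φ lam D h V - bonus M φ lam D β h V s a)
    ((M.H : ℝ) - (h : ℕ))) 0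

/-- The stage-`h` policies in the `μ`-supported class `Π_h(μ)`. -/
def supportedClass (B : ℕ → S → Set A) (h : ℕ) : Set (S → PMF A) :=
  {ρ | ∀ s ∈ feasibleStates M h, (ρ s).support ⊆ B h s}

/-- `ρ` is a maximizer of `⟨Q, ρ⟩` over `Π_h(μ)` (at every state simultaneously). -/
def IsGreedy (B : ℕ → S → Set A) (h : ℕ) (Q : S → A → ℝ) (ρ : S → PMF A) : Prop :=
  ρ ∈ supportedClass M B h ∧
    ∀ ρ' ∈ supportedClass M B h, ∀ s, pexp (ρ' s) (Q s) ≤ pexp (ρ s) (Q s)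

/-- `π` is the policy that one iteration of BCP-VTR computes from the episodes `D`, backwards from
the last stage, for some choice of the maximizers; `V h` is the value estimate `V̂_h`. -/
def IsIterate (B : ℕ → S → Set A) (β : ℝ) (π : Policy S A) : Prop :=
  ∃ V : ℕ → S → ℝ, (∀ s, V M.H s = 0) ∧ ∀ h : Fin M.H,
    IsGreedy M B h (qHat M φ lam D β h (V (h + 1))) (π h) ∧
    ∀ s, V h s = pexp (π h s) (qHat M φ lam D β h (V (h + 1)) s)

end Algorithm

/-- `β_k = H √(d log ((H + k H³ / λ) / δ)) + √λ C_w`. -/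
def betaVTR (d H : ℕ) (lam Cw δ : ℝ) (k : ℕ) : ℝ :=
  H * √(d * Real.log ((H + k * (H : ℝ) ^ 3 / lam) / δ)) + √lam * Cw

/-- `π n D` is the policy `π̂^{n+1}`, computed from the first `n` episodes `D`; this says that
`π̂^1, …, π̂^{K+1}` is the ensemble produced by BCP-VTR. -/
def IsEnsemble (M : MDP S A) (φ : S → A → S → EuclideanSpace ℝ (Fin d)) (μ : Collector M) (K : ℕ)
    (B : ℕ → S → Set A) (lam Cw δ : ℝ) (π : (n : ℕ) → (Fin n → Traj M) → Policy S A) : Prop :=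
  ∀ n ≤ K, ∀ D ∈ (dataLaw M μ n).support,
    IsIterate M φ lam D B (betaVTR d M.H lam Cw δ (n + 1)) (π n D)

/-- Sub-optimality of the mixture policy given the data, in expectation over the uniformly drawn
member of `π̂^1, …, π̂^K` that is executed. -/
def subOptMix (M : MDP S A) {K : ℕ} (π : (n : ℕ) → (Fin n → Traj M) → Policy S A)
    (D : Fin K → Traj M) : ℝ :=
  (∑ k : Fin K, subOpt M (π k (firstEpisodes D k k.isLt.le))) / K

/-- Sub-optimality of the last iterate `π̂^{K+1}` given the data. -/
def subOptLast (M : MDP S A) {K : ℕ} (π : (n : ℕ) → (Fin n → Traj M) → Policy S A)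
    (D : Fin K → Traj M) : ℝ :=
  subOpt M (π K D)

end OfflineRL

end

namespace OfflineRL

open scoped ENNReal

/-! ### Expectations under discrete distributions -/

section Discrete

variable {X Y : Type*}

/-! All behaviour policies have the same action supports at feasible states, so they visit the same
pairs at stage `h`. A positive lower bound on visitation masses makes this set `X h` finite, with at
most `κ_h` elements. Both the optimal policy (by concentrability) and every iterate (by its support
constraint) stay inside `X h`. Estimates therefore only have to be accurate on `X h`
(`exists_covers`).

Accuracy has two ingredients. The first is a bound on the width of the confidence ellipsoid: a
feature vector that occurs `N` times in the ridge design has squared inverse-Gram norm at most `1 /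
N` (`card_mul_ridge_quadForm_le`). With high probability each pair of `X h` is visited at least `n /
(4 κ_h)` times in the first `n` episodes, once `n` exceeds a multiple of `κ` times the logarithmic
factor.

The second is a noise bound that is uniform over all bounded `V`, so that the dependence of the
value estimate on the same data is harmless. The regression coefficients are functions on the finite
set `X h`, and the noise is linear in `V`. Hence it is enough to control a grid of coefficient
functions and the indicators of subsets of the finite set of next states (`abs_sum_noise_le`).
Exponential supermartingales and a union bound do this; the logarithm of the number of tests is of
order `κ_h + κ_{h+1}` up to logarithms.

Together they bound the Bellman error at stage `h` by a multiple of `H d (1 + Cw) (κ_h + κ_{h+1}) /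
√n` up to logarithms (`abs_qHat_sub_le`, `stage_error_le`). Pessimism plays no role here: the bonus
is simply counted as part of a two-sided error. Telescoping along the optimal policy and along the
iterate gives sub-optimality at most twice the sum of these errors (`subOpt_le_two_mul_sum`), and
the sum over stages produces `κ`. Averaging `1 / √k` over the iterates gives the mixture bound. When
`κ > √K` the claim is trivial, since sub-optimality never exceeds `H`. -/

/-- Expectation of an extended nonnegative function under a discrete distribution. -/
noncomputable def eexp (p : PMF X) (F : X → ℝ≥0∞) : ℝ≥0∞ := ∑' x, p x * F x

lemma eexp_pure (x : X) (F : X → ℝ≥0∞) : eexp (PMF.pure x) F = F x := by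
  classical
  rw [eexp, tsum_eq_single x]
  · simp
  · intro y hy
    simp [PMF.pure_apply, hy]

lemma eexp_bind (p : PMF X) (q : X → PMF Y) (F : Y → ℝ≥0∞) :
    eexp (p.bind q) F = eexp p fun x => eexp (q x) F := by
  simp only [eexp, PMF.bind_apply, ← ENNReal.tsum_mul_right, ← ENNReal.tsum_mul_left]
  rw [ENNReal.tsum_comm]
  simp only [mul_assoc]

lemma eexp_mono {p : PMF X} {F G : X → ℝ≥0∞} (h : ∀ x ∈ p.support, F x ≤ G x) :
    eexp p F ≤ eexp p G := by
  refine ENNReal.tsum_le_tsum fun x => ?_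
  by_cases hx : x ∈ p.support
  · gcongr
    exact h x hx
  · simp [(PMF.apply_eq_zero_iff p x).2 hx]

lemma eexp_congr {p : PMF X} {F G : X → ℝ≥0∞} (h : ∀ x ∈ p.support, F x = G x) :
    eexp p F = eexp p G :=
  le_antisymm (eexp_mono fun x hx => (h x hx).le) (eexp_mono fun x hx => (h x hx).ge)

lemma eexp_const (p : PMF X) (c : ℝ≥0∞) : eexp p (fun _ => c) = c := by
  simp [eexp, ENNReal.tsum_mul_right]

lemma eexp_mul_const (p : PMF X) (F : X → ℝ≥0∞) (c : ℝ≥0∞) :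
    eexp p (fun x => F x * c) = eexp p F * c := by
  simp [eexp, ← ENNReal.tsum_mul_right, mul_assoc]

lemma eexp_const_mul (p : PMF X) (F : X → ℝ≥0∞) (c : ℝ≥0∞) :
    eexp p (fun x => c * F x) = c * eexp p F := by
  simp only [mul_comm c, eexp_mul_const]

lemma eexp_sum {ι : Type*} (p : PMF X) (T : Finset ι) (F : ι → X → ℝ≥0∞) :
    eexp p (fun x => ∑ i ∈ T, F i x) = ∑ i ∈ T, eexp p (F i) := by
  classical
  simp only [eexp, Finset.mul_sum]
  exact Summable.tsum_finsetSum fun _ _ => ENNReal.summable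

lemma le_eexp (p : PMF X) (F : X → ℝ≥0∞) (x : X) : p x * F x ≤ eexp p F :=
  ENNReal.le_tsum x

/-- The hypothesis says that `q` is the image law of `p` under `f`. Testing it on the indicator of
the complement of the support of `q` transfers almost sure facts from marginals to full
trajectories. -/
lemma mem_support_of_eexp_comp {p : PMF X} {q : PMF Y} {f : X → Y}
    (h : ∀ F, eexp p (fun x => F (f x)) = eexp q F) {x : X} (hx : x ∈ p.support) :
    f x ∈ q.support := by
  classical
  by_contra hcon
  have h0 : eexp q (q.supportᶜ.indicator 1) = 0 := by
    rw [eexp, ENNReal.tsum_eq_zero]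
    intro y
    by_cases hy : y ∈ q.support
    · simp [hy]
    · simp [(PMF.apply_eq_zero_iff _ _).2 hy]
  rw [← h] at h0
  have h1 := le_eexp p (fun x => q.supportᶜ.indicator 1 (f x)) x
  rw [h0, Set.indicator_of_mem hcon, Pi.one_apply, mul_one, nonpos_iff_eq_zero] at h1
  exact (PMF.mem_support_iff _ _).1 hx h1

lemma toOuterMeasure_eq_eexp (p : PMF X) (E : Set X) :
    p.toOuterMeasure E = eexp p (E.indicator 1) := by
  rw [PMF.toOuterMeasure_apply, eexp]
  refine tsum_congr fun x => ?_
  by_cases hx : x ∈ E <;> simp [hx]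

lemma toOuterMeasure_le_one (p : PMF X) (E : Set X) : p.toOuterMeasure E ≤ 1 := by
  rw [toOuterMeasure_eq_eexp]
  refine (eexp_mono (G := fun _ => 1) fun x _ => ?_).trans (eexp_const p 1).le
  by_cases hx : x ∈ E <;> simp [hx]

/-- Markov's inequality. -/
lemma toOuterMeasure_le_of_one_le {p : PMF X} {E : Set X} {F : X → ℝ≥0∞} {c δ : ℝ≥0∞}
    (hF : eexp p F ≤ c) (h : ∀ x ∈ p.support, x ∈ E → 1 ≤ F x * δ) :
    p.toOuterMeasure E ≤ c * δ := by
  rw [toOuterMeasure_eq_eexp]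
  calc eexp p (E.indicator 1) ≤ eexp p fun x => F x * δ := by
        refine eexp_mono fun x hx => ?_
        by_cases hE : x ∈ E
        · simpa [hE] using h x hx hE
        · simp [hE]
    _ = eexp p F * δ := eexp_mul_const p F δ
    _ ≤ c * δ := by gcongr

lemma one_le_prob_add {p : PMF X} {E F : Set X} (h : ∀ x ∈ p.support, x ∈ E ∨ x ∈ F) :
    1 ≤ prob p E + prob p F := by
  have h1 : (1 : ℝ≥0∞) ≤ p.toOuterMeasure E + p.toOuterMeasure F := by
    calc (1 : ℝ≥0∞) = p.toOuterMeasure p.support :=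
          ((PMF.toOuterMeasure_apply_eq_one_iff p _).2 subset_rfl).symm
      _ ≤ p.toOuterMeasure (E ∪ F) := MeasureTheory.measure_mono h
      _ ≤ _ := MeasureTheory.measure_union_le E F
  have hfin : ∀ G : Set X, p.toOuterMeasure G ≠ ∞ := fun G =>
    ((toOuterMeasure_le_one p G).trans_lt ENNReal.one_lt_top).ne
  have := ENNReal.toReal_mono (ENNReal.add_ne_top.2 ⟨hfin E, hfin F⟩) h1
  rwa [ENNReal.toReal_one, ENNReal.toReal_add (hfin E) (hfin F)] at this

/-! ### Real expectations of bounded functions -/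

lemma summable_toReal (p : PMF X) : Summable fun x => (p x).toReal :=
  ENNReal.summable_toReal p.tsum_coe_ne_top

lemma tsum_toReal (p : PMF X) : ∑' x, (p x).toReal = 1 := by
  rw [← ENNReal.tsum_toReal_eq fun x => p.apply_ne_top x, p.tsum_coe, ENNReal.toReal_one]

lemma summable_pexp (p : PMF X) {f : X → ℝ} {c : ℝ} (hf : ∀ x, |f x| ≤ c) :
    Summable fun x => (p x).toReal * f x := by
  refine Summable.of_norm_bounded ((summable_toReal p).mul_right c) fun x => ?_
  rw [norm_mul, Real.norm_eq_abs, Real.norm_eq_abs, abs_of_nonneg ENNReal.toReal_nonneg]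
  exact mul_le_mul_of_nonneg_left (hf x) ENNReal.toReal_nonneg

lemma pexp_const (p : PMF X) (c : ℝ) : pexp p (fun _ => c) = c := by
  rw [pexp, tsum_mul_right, tsum_toReal, one_mul]

lemma pexp_add (p : PMF X) {f g : X → ℝ} {c c' : ℝ} (hf : ∀ x, |f x| ≤ c)
    (hg : ∀ x, |g x| ≤ c') : pexp p (fun x => f x + g x) = pexp p f + pexp p g := by
  simp only [pexp, mul_add]
  exact (summable_pexp p hf).tsum_add (summable_pexp p hg)

lemma pexp_const_mul (p : PMF X) (c : ℝ) (f : X → ℝ) :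
    pexp p (fun x => c * f x) = c * pexp p f := by
  simp only [pexp, ← tsum_mul_left]
  exact tsum_congr fun x => by ring

lemma pexp_mono {p : PMF X} {f g : X → ℝ} {c c' : ℝ} (hf : ∀ x, |f x| ≤ c)
    (hg : ∀ x, |g x| ≤ c') (h : ∀ x ∈ p.support, f x ≤ g x) : pexp p f ≤ pexp p g := by
  refine (summable_pexp p hf).tsum_le_tsum (fun x => ?_) (summable_pexp p hg)
  by_cases hx : x ∈ p.support
  · exact mul_le_mul_of_nonneg_left (h x hx) ENNReal.toReal_nonneg
  · simp [(PMF.apply_eq_zero_iff p x).2 hx]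

lemma pexp_le_add {p : PMF X} {f g : X → ℝ} {c c' e : ℝ} (hf : ∀ x, |f x| ≤ c)
    (hg : ∀ x, |g x| ≤ c') (h : ∀ x ∈ p.support, f x ≤ g x + e) :
    pexp p f ≤ pexp p g + e := by
  have he : ∀ x : X, |(fun _ => e) x| ≤ |e| := fun _ => le_rfl
  rw [← pexp_const p e, ← pexp_add p hg he]
  refine pexp_mono hf (c' := c' + |e|) (fun x => ?_) h
  exact (abs_add_le _ _).trans (add_le_add (hg x) le_rfl)

lemma pexp_mem_Icc {p : PMF X} {f : X → ℝ} {c : ℝ} (hf : ∀ x, 0 ≤ f x ∧ f x ≤ c) :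
    0 ≤ pexp p f ∧ pexp p f ≤ c := by
  have hb : ∀ x, |f x| ≤ c := fun x => by rw [abs_of_nonneg (hf x).1]; exact (hf x).2
  refine ⟨tsum_nonneg fun x => mul_nonneg ENNReal.toReal_nonneg (hf x).1, ?_⟩
  calc pexp p f ≤ pexp p (fun _ => c) :=
        pexp_mono hb (c' := |c|) (fun _ => le_rfl) fun x _ => (hf x).2
    _ = c := pexp_const p c

lemma eexp_ofReal (p : PMF X) {f : X → ℝ} {c : ℝ} (h0 : ∀ x, 0 ≤ f x) (hf : ∀ x, f x ≤ c) :
    eexp p (fun x => ENNReal.ofReal (f x)) = ENNReal.ofReal (pexp p f) := by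
  have hb : ∀ x, |f x| ≤ c := fun x => by rw [abs_of_nonneg (h0 x)]; exact hf x
  rw [pexp, ENNReal.ofReal_tsum_of_nonneg
    (fun x => mul_nonneg ENNReal.toReal_nonneg (h0 x)) (summable_pexp p hb)]
  refine tsum_congr fun x => ?_
  rw [ENNReal.ofReal_mul ENNReal.toReal_nonneg, ENNReal.ofReal_toReal (p.apply_ne_top x)]

lemma pexp_indicator (p : PMF X) (E : Set X) : pexp p (E.indicator 1) = prob p E := by
  rw [prob, PMF.toOuterMeasure_apply, ENNReal.tsum_toReal_eq, pexp]
  · refine tsum_congr fun x => ?_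
    by_cases hx : x ∈ E <;> simp [hx]
  · intro x
    by_cases hx : x ∈ E <;> simp [hx, p.apply_ne_top x]

/-- A function with values in `[0, c]` that is at most `b` off an event `E`. -/
lemma pexp_le_add_prob {p : PMF X} {f : X → ℝ} {b c : ℝ} {E : Set X} (hb : 0 ≤ b)
    (hf : ∀ x, 0 ≤ f x ∧ f x ≤ c) (h : ∀ x ∈ p.support, x ∉ E → f x ≤ b) :
    pexp p f ≤ b + c * prob p E := by
  classical
  have h1 : ∀ x, |c * E.indicator (1 : X → ℝ) x| ≤ |c| := fun x => by
    by_cases hx : x ∈ E <;> simp [hx]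
  have := pexp_le_add (p := p) (e := b) (c := c) (f := f)
    (fun x => by rw [abs_of_nonneg (hf x).1]; exact (hf x).2) h1 (fun x hx => by
      by_cases hE : x ∈ E
      · simpa [hE] using (hf x).2.trans (le_add_of_nonneg_right hb)
      · simpa [hE] using h x hx hE)
  rwa [pexp_const_mul, pexp_indicator, add_comm] at this

end Discrete

/-! ### Ridge regression -/

section Ridge

lemma dotProduct_self_nonneg_real {d : ℕ} (z : Fin d → ℝ) : 0 ≤ z ⬝ᵥ z :=
  Finset.sum_nonneg fun i _ => mul_self_nonneg (z i)

variable {n d : ℕ} (v : Fin n → Fin d → ℝ)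

/-- The regularized Gram matrix of a finite family of vectors. -/
def ridge : Matrix (Fin d) (Fin d) ℝ :=
  ∑ t, Matrix.vecMulVec (v t) (v t) + (1 : ℝ) • (1 : Matrix (Fin d) (Fin d) ℝ)

lemma ridge_mulVec (z : Fin d → ℝ) : ridge v *ᵥ z = ∑ t, (v t ⬝ᵥ z) • v t + z := by
  rw [ridge, Matrix.add_mulVec, one_smul, Matrix.one_mulVec, Matrix.sum_mulVec]
  congr 1
  refine Finset.sum_congr rfl fun t _ => ?_
  rw [Matrix.vecMulVec_mulVec]
  ext i
  simp [mul_comm]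

lemma dotProduct_ridge_mulVec (y z : Fin d → ℝ) :
    y ⬝ᵥ (ridge v *ᵥ z) = ∑ t, (v t ⬝ᵥ z) * (v t ⬝ᵥ y) + y ⬝ᵥ z := by
  rw [ridge_mulVec, dotProduct_add, dotProduct_sum]
  congr 1
  refine Finset.sum_congr rfl fun t _ => ?_
  rw [dotProduct_smul, smul_eq_mul, dotProduct_comm y]

lemma isUnit_det_ridge : IsUnit (ridge v).det := by
  rw [← Matrix.isUnit_iff_isUnit_det, ← Matrix.mulVec_injective_iff_isUnit]
  refine (injective_iff_map_eq_zero (ridge v).mulVecLin).2 fun z hz => ?_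
  have hz' : ridge v *ᵥ z = 0 := hz
  have h := dotProduct_ridge_mulVec v z z
  rw [hz', dotProduct_zero] at h
  have h1 : 0 ≤ ∑ t, (v t ⬝ᵥ z) * (v t ⬝ᵥ z) := Finset.sum_nonneg fun t _ => mul_self_nonneg _
  have h2 : 0 ≤ z ⬝ᵥ z := dotProduct_self_nonneg_real z
  exact dotProduct_self_eq_zero.1 (by linarith)

/-- The solution `z` of the normal equation with right-hand side `u`. -/
lemma ridge_mulVec_inv (u : Fin d → ℝ) : ridge v *ᵥ ((ridge v)⁻¹ *ᵥ u) = u := by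
  rw [Matrix.mulVec_mulVec, Matrix.mul_nonsing_inv _ (isUnit_det_ridge v), Matrix.one_mulVec]

lemma dotProduct_ridge_inv (u b : Fin d → ℝ) :
    u ⬝ᵥ ((ridge v)⁻¹ *ᵥ b) = ((ridge v)⁻¹ *ᵥ u) ⬝ᵥ b := by
  have h1 := dotProduct_ridge_mulVec v ((ridge v)⁻¹ *ᵥ u) ((ridge v)⁻¹ *ᵥ b)
  have h2 := dotProduct_ridge_mulVec v ((ridge v)⁻¹ *ᵥ b) ((ridge v)⁻¹ *ᵥ u)
  rw [ridge_mulVec_inv] at h1 h2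
  rw [h1, dotProduct_comm u, h2, dotProduct_comm ((ridge v)⁻¹ *ᵥ b)]
  simp only [mul_comm]

/-- The squared norm of `u` with respect to the inverse Gram matrix. -/
lemma ridge_quadForm (u : Fin d → ℝ) :
    u ⬝ᵥ ((ridge v)⁻¹ *ᵥ u) = ∑ t, (v t ⬝ᵥ ((ridge v)⁻¹ *ᵥ u)) ^ 2 +
      ((ridge v)⁻¹ *ᵥ u) ⬝ᵥ ((ridge v)⁻¹ *ᵥ u) := by
  have h1 := dotProduct_ridge_mulVec v ((ridge v)⁻¹ *ᵥ u) ((ridge v)⁻¹ *ᵥ u)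
  rw [ridge_mulVec_inv] at h1
  rw [dotProduct_comm, h1]
  simp only [sq]

lemma ridge_quadForm_nonneg (u : Fin d → ℝ) : 0 ≤ u ⬝ᵥ ((ridge v)⁻¹ *ᵥ u) := by
  rw [ridge_quadForm]
  exact add_nonneg (Finset.sum_nonneg fun t _ => sq_nonneg _) (dotProduct_self_nonneg_real _)

lemma sum_sq_le_ridge_quadForm (u : Fin d → ℝ) :
    ∑ t, (v t ⬝ᵥ ((ridge v)⁻¹ *ᵥ u)) ^ 2 ≤ u ⬝ᵥ ((ridge v)⁻¹ *ᵥ u) := by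
  rw [ridge_quadForm]
  exact le_add_of_nonneg_right (dotProduct_self_nonneg_real _)

/-- A vector that occurs `N` times in the design has squared norm at most `1 / N`. -/
lemma card_mul_ridge_quadForm_le (u : Fin d → ℝ) (T : Finset (Fin n)) (hT : ∀ t ∈ T, v t = u) :
    (T.card : ℝ) * (u ⬝ᵥ ((ridge v)⁻¹ *ᵥ u)) ≤ 1 := by
  set q := u ⬝ᵥ ((ridge v)⁻¹ *ᵥ u) with hq
  have h0 : 0 ≤ q := ridge_quadForm_nonneg v u
  -- For `t ∈ T` the pairing of `v t` with the solution of the normal equation is `q` itself, so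
  -- these terms alone contribute `card T * q ^ 2` to a sum bounded by `q`.
  have h1 : (T.card : ℝ) * q ^ 2 ≤ q := by
    calc (T.card : ℝ) * q ^ 2 = ∑ t ∈ T, (v t ⬝ᵥ ((ridge v)⁻¹ *ᵥ u)) ^ 2 := by
          rw [Finset.sum_congr rfl fun t ht => by rw [hT t ht], Finset.sum_const, nsmul_eq_mul]
      _ ≤ ∑ t, (v t ⬝ᵥ ((ridge v)⁻¹ *ᵥ u)) ^ 2 :=
          Finset.sum_le_sum_of_subset_of_nonneg (Finset.subset_univ _) fun _ _ _ => sq_nonneg _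
      _ ≤ q := sum_sq_le_ridge_quadForm v u
  rcases h0.eq_or_lt with h | h
  · rw [← h]; simp
  · refine le_of_mul_le_mul_right ?_ h
    linarith [h1, sq q]

/-- The error of the ridge estimate in the direction `u`. -/
lemma ridge_error (u w : Fin d → ℝ) (y η : Fin n → ℝ) (hy : ∀ t, y t = v t ⬝ᵥ w + η t) :
    u ⬝ᵥ ((ridge v)⁻¹ *ᵥ ∑ t, y t • v t) - u ⬝ᵥ w =
      ∑ t, (v t ⬝ᵥ ((ridge v)⁻¹ *ᵥ u)) * η t - ((ridge v)⁻¹ *ᵥ u) ⬝ᵥ w := by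
  have h := dotProduct_ridge_mulVec v w ((ridge v)⁻¹ *ᵥ u)
  rw [ridge_mulVec_inv] at h
  rw [dotProduct_ridge_inv, dotProduct_comm u w, h, dotProduct_sum, dotProduct_comm w,
    ← sub_sub, ← Finset.sum_sub_distrib]
  congr 1
  refine Finset.sum_congr rfl fun t _ => ?_
  rw [dotProduct_smul, smul_eq_mul, hy, dotProduct_comm _ (v t)]
  ring

lemma abs_dotProduct_le (z w : Fin d → ℝ) : |z ⬝ᵥ w| ≤ √(z ⬝ᵥ z) * √(w ⬝ᵥ w) := by
  rw [← Real.sqrt_mul (dotProduct_self_nonneg_real z)]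
  refine Real.abs_le_sqrt ?_
  have := Finset.sum_mul_sq_le_sq_mul_sq Finset.univ z w
  simpa [dotProduct, sq] using this

/-- If the noise `η` satisfies `|∑ g_t η_t| ≤ c ‖g‖` for the coefficients `g` of the estimate in the
direction `u`, the error is at most `(c + ‖w‖) ‖u‖` in the norm of the inverse Gram matrix. -/
lemma abs_ridge_error_le (u w : Fin d → ℝ) (y η : Fin n → ℝ) (hy : ∀ t, y t = v t ⬝ᵥ w + η t)
    {c Cw : ℝ} (hc : 0 ≤ c) (hw : √(w ⬝ᵥ w) ≤ Cw)
    (hη : |∑ t, (v t ⬝ᵥ ((ridge v)⁻¹ *ᵥ u)) * η t| ≤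
      c * √(∑ t, (v t ⬝ᵥ ((ridge v)⁻¹ *ᵥ u)) ^ 2)) :
    |u ⬝ᵥ ((ridge v)⁻¹ *ᵥ ∑ t, y t • v t) - u ⬝ᵥ w| ≤
      (c + Cw) * √(u ⬝ᵥ ((ridge v)⁻¹ *ᵥ u)) := by
  rw [ridge_error v u w y η hy, add_mul]
  refine (abs_sub _ _).trans (add_le_add (hη.trans ?_) ((abs_dotProduct_le _ _).trans ?_))
  · exact mul_le_mul_of_nonneg_left (Real.sqrt_le_sqrt (sum_sq_le_ridge_quadForm v u)) hc
  · rw [mul_comm]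
    refine mul_le_mul hw (Real.sqrt_le_sqrt ?_) (Real.sqrt_nonneg _)
      ((Real.sqrt_nonneg _).trans hw)
    rw [ridge_quadForm v u]
    exact le_add_of_nonneg_left (Finset.sum_nonneg fun t _ => sq_nonneg _)

end Ridge

universe u v

variable {S : Type u} {A : Type v}

/-! ### Values -/

section Values

variable (M : MDP S A)

lemma valueFrom_mem_Icc (π : Policy S A) (j h : ℕ) (s : S) :
    0 ≤ valueFrom M π j h s ∧ valueFrom M π j h s ≤ j := by
  induction j generalizing h s with
  | zero => simp [valueFrom]
  | succ j ih =>
    rw [valueFrom]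
    refine pexp_mem_Icc fun a => ?_
    have := pexp_mem_Icc (p := M.P h s a) (ih (h + 1))
    push_cast
    exact ⟨add_nonneg (M.r_nonneg h s a) this.1, by linarith [M.r_le_one h s a, this.2]⟩

lemma value_mem_Icc (π : Policy S A) : 0 ≤ value M π ∧ value M π ≤ M.H :=
  pexp_mem_Icc fun s => valueFrom_mem_Icc M π M.H 0 s

lemma bddAbove_value : BddAbove (Set.range fun π : Policy S A => value M π) :=
  ⟨M.H, by rintro _ ⟨π, rfl⟩; exact (value_mem_Icc M π).2⟩

lemma subOpt_mem_Icc (π : Policy S A) : 0 ≤ subOpt M π ∧ subOpt M π ≤ M.H := by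
  have : Nonempty (Policy S A) := ⟨π⟩
  refine ⟨sub_nonneg.2 (le_ciSup (bddAbove_value M) π), ?_⟩
  have h : optValue M ≤ M.H := ciSup_le fun π' => (value_mem_Icc M π').2
  have := (value_mem_Icc M π).1
  rw [subOpt]
  linarith

lemma subOpt_eq_of_isOptimal {πs : Policy S A} (h : IsOptimal M πs) (π : Policy S A) :
    subOpt M π = value M πs - value M π := by
  have : Nonempty (Policy S A) := ⟨π⟩
  rw [subOpt, optValue, le_antisymm (ciSup_le h) (le_ciSup (bddAbove_value M) πs)]

end Values

/-! ### Occupancies -/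

section Occupancy

variable (M : MDP S A)

/-- The law of the state-action pair at stage `h`. -/
noncomputable def pairOcc (π : Policy S A) (h : ℕ) : PMF (S × A) :=
  (stateOcc M π h).bind fun s => (π h s).bind fun a => PMF.pure (s, a)

lemma eexp_pairOcc (π : Policy S A) (h : ℕ) (F : S × A → ℝ≥0∞) :
    eexp (pairOcc M π h) F =
      eexp (stateOcc M π h) fun s => eexp (π h s) fun a => F (s, a) := by
  simp only [pairOcc, eexp_bind, eexp_pure]

lemma mem_support_pairOcc {π : Policy S A} {h : ℕ} {x : S × A} :
    x ∈ (pairOcc M π h).support ↔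
      x.1 ∈ (stateOcc M π h).support ∧ x.2 ∈ (π h x.1).support := by
  obtain ⟨s, a⟩ := x
  simp only [pairOcc, PMF.mem_support_bind_iff, PMF.support_pure, Set.mem_singleton_iff]
  constructor
  · rintro ⟨s', hs', a', ha', h⟩
    obtain ⟨rfl, rfl⟩ := Prod.mk.inj h
    exact ⟨hs', ha'⟩
  · rintro ⟨hs, ha⟩
    exact ⟨s, hs, a, ha, rfl⟩

lemma pairOcc_apply (π : Policy S A) (h : ℕ) (x : S × A) :
    pairOcc M π h x = stateOcc M π h x.1 * π h x.1 x.2 := by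
  classical
  obtain ⟨s, a⟩ := x
  simp only [pairOcc, PMF.bind_apply]
  rw [tsum_eq_single s, tsum_eq_single a]
  · simp
  · intro a' ha'
    simp [PMF.pure_apply, Ne.symm ha']
  · intro s' hs'
    simp [PMF.pure_apply, Ne.symm hs']

lemma toReal_pairOcc (π : Policy S A) (h : ℕ) (x : S × A) :
    (pairOcc M π h x).toReal = occ M π h x.1 x.2 := by
  rw [pairOcc_apply, ENNReal.toReal_mul, occ]

lemma occ_pos_iff {π : Policy S A} {h : ℕ} {s : S} {a : A} :
    0 < occ M π h s a ↔ (s, a) ∈ (pairOcc M π h).support := by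
  rw [← toReal_pairOcc M π h (s, a), ENNReal.toReal_pos_iff, PMF.mem_support_iff, pos_iff_ne_zero]
  exact and_iff_left (lt_top_iff_ne_top.2 (PMF.apply_ne_top _ _))

lemma mem_support_stateOcc_succ {π : Policy S A} {h : ℕ} {x : S × A} {s' : S}
    (hx : x ∈ (pairOcc M π h).support) (hs' : s' ∈ (M.P h x.1 x.2).support) :
    s' ∈ (stateOcc M π (h + 1)).support := by
  rw [mem_support_pairOcc] at hx
  simp only [stateOcc, PMF.mem_support_bind_iff]
  exact ⟨x.1, hx.1, x.2, hx.2, hs'⟩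

/-- Reachability depends only on which actions have positive probability, not on their
probabilities. -/
lemma support_stateOcc_subset {ρ ρ' : Policy S A} {H : ℕ}
    (h : ∀ i < H, ∀ s ∈ (stateOcc M ρ i).support, (ρ i s).support ⊆ (ρ' i s).support)
    {i : ℕ} (hi : i ≤ H) : (stateOcc M ρ i).support ⊆ (stateOcc M ρ' i).support := by
  induction i with
  | zero => exact subset_rfl
  | succ i ih =>
    intro s' hs'
    simp only [stateOcc, PMF.mem_support_bind_iff] at hs' ⊢
    obtain ⟨s, hs, a, ha, hP⟩ := hs'
    exact ⟨s, ih (by omega) hs, a, h i (by omega) s hs ha, hP⟩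

lemma mem_feasibleStates {π : Policy S A} {h : ℕ} {s : S} (hs : s ∈ (stateOcc M π h).support) :
    s ∈ feasibleStates M h := ⟨π, hs⟩

/-- If all positive visitation masses are at least `c`, then at most `1 / c` pairs are visited. -/
lemma finite_support_of_le {X : Type*} {p : PMF X} {c : ℝ} (hc : 0 < c)
    (h : ∀ x ∈ p.support, c ≤ (p x).toReal) :
    p.support.Finite ∧ (p.support.ncard : ℝ) ≤ c⁻¹ := by
  have key : ∀ T : Finset X, (T : Set X) ⊆ p.support → (T.card : ℝ) ≤ c⁻¹ := by
    intro T hT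
    rw [← one_div, le_div_iff₀ hc]
    calc (T.card : ℝ) * c = ∑ _x ∈ T, c := by rw [Finset.sum_const, nsmul_eq_mul]
      _ ≤ ∑ x ∈ T, (p x).toReal := Finset.sum_le_sum fun x hx => h x (hT hx)
      _ ≤ ∑' x, (p x).toReal :=
          (summable_toReal p).sum_le_tsum T fun _ _ => ENNReal.toReal_nonneg
      _ = 1 := tsum_toReal p
  have hfin : p.support.Finite := by
    by_contra hinf
    -- An infinite support would contain a finite set just larger than the bound `c⁻¹` valid for
    -- every finite subset.
    obtain ⟨T, hT, hcard⟩ := Set.Infinite.exists_subset_card_eq hinf (⌊c⁻¹⌋₊ + 1)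
    have h1 := key T hT
    have h2 := Nat.lt_floor_add_one c⁻¹
    rw [hcard] at h1
    push_cast at h1
    linarith
  refine ⟨hfin, ?_⟩
  have := key hfin.toFinset (by simp)
  rwa [Set.ncard_eq_toFinset_card _ hfin]

end Occupancy

/-! ### The laws of trajectories and data -/

section Laws

variable (M : MDP S A)

lemma eexp_prefixLaw_succ (π : Policy S A) (n : ℕ) (F : (Fin (n + 1) → S × A) → ℝ≥0∞) :
    eexp (prefixLaw M π (n + 1)) F = eexp (prefixLaw M π n) fun τ =>
      eexp (nextState M n τ) fun s => eexp (π n s) fun a =>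
        F (Fin.snoc (α := fun _ => S × A) τ (s, a)) := by
  simp only [prefixLaw, eexp_bind, eexp_pure]

lemma eexp_nextState (π : Policy S A) (n : ℕ) (G : S → ℝ≥0∞) :
    eexp (prefixLaw M π n) (fun τ => eexp (nextState M n τ) G) = eexp (stateOcc M π n) G := by
  induction n generalizing G with
  | zero => simp only [prefixLaw, nextState, stateOcc, eexp_pure]
  | succ n ih =>
    simp only [eexp_prefixLaw_succ, nextState, Fin.snoc_last, stateOcc, eexp_bind]
    exact ih fun s => eexp (π n s) fun a => eexp (M.P n s a) G

lemma eexp_prefixLaw_coord (π : Policy S A) {n : ℕ} (h : Fin n) (F : S × A → ℝ≥0∞) :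
    eexp (prefixLaw M π n) (fun τ => F (τ h)) = eexp (pairOcc M π h) F := by
  induction n with
  | zero => exact h.elim0
  | succ n ih =>
    rw [eexp_prefixLaw_succ]
    refine Fin.lastCases ?_ (fun i => ?_) h
    · simp only [Fin.snoc_last, Fin.val_last, eexp_pairOcc]
      exact eexp_nextState M π n fun s => eexp (π n s) fun a => F (s, a)
    · simp only [Fin.snoc_castSucc, eexp_const, Fin.val_castSucc]
      exact ih i

/-- The Markov property in the only form needed: given the pair at stage `h`, the next state has the
transition law. Later stages integrate to one. -/
lemma eexp_prefixLaw_pair (π : Policy S A) {n : ℕ} (h : ℕ) (hh : h + 1 < n)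
    (F : S × A → S → ℝ≥0∞) :
    eexp (prefixLaw M π n) (fun τ => F (τ ⟨h, by omega⟩) (τ ⟨h + 1, hh⟩).1) =
      eexp (pairOcc M π h) fun x => eexp (M.P h x.1 x.2) (F x) := by
  induction n with
  | zero => omega
  | succ n ih =>
    rw [eexp_prefixLaw_succ]
    rcases Nat.lt_succ_iff_lt_or_eq.1 hh with hlt | heq
    · have e1 : (⟨h, by omega⟩ : Fin (n + 1)) = Fin.castSucc ⟨h, by omega⟩ := rfl
      have e2 : (⟨h + 1, hh⟩ : Fin (n + 1)) = Fin.castSucc ⟨h + 1, hlt⟩ := rfl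
      simp only [e1, e2, Fin.snoc_castSucc, eexp_const]
      exact ih hlt
    · subst heq
      have e1 : (⟨h, by omega⟩ : Fin (h + 1 + 1)) = Fin.castSucc (Fin.last h) := rfl
      have e2 : (⟨h + 1, hh⟩ : Fin (h + 1 + 1)) = Fin.last (h + 1) := rfl
      simp only [e1, e2, Fin.snoc_castSucc, Fin.snoc_last, eexp_const, nextState]
      exact eexp_prefixLaw_coord M π (Fin.last h) fun x => eexp (M.P h x.1 x.2) (F x)

variable {M} (μ : Collector M)

lemma eexp_dataLaw_succ (n : ℕ) (F : (Fin (n + 1) → Traj M) → ℝ≥0∞) :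
    eexp (dataLaw M μ (n + 1)) F = eexp (dataLaw M μ n) fun D =>
      eexp (trajLaw M (μ n D)) fun τ => F (Fin.snoc (α := fun _ => Traj M) D τ) := by
  simp only [dataLaw, eexp_bind, eexp_pure]

/-- A product of conditional expectations that are at most one is at most one. -/
lemma eexp_dataLaw_prod_le {K : ℕ} (f : Traj M → ℝ≥0∞)
    (hf : ∀ n < K, ∀ D ∈ (dataLaw M μ n).support, eexp (trajLaw M (μ n D)) f ≤ 1)
    {n : ℕ} (hn : n ≤ K) : eexp (dataLaw M μ n) (fun D => ∏ t, f (D t)) ≤ 1 := by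
  induction n with
  | zero => simp [eexp_const]
  | succ n ih =>
    rw [eexp_dataLaw_succ]
    simp only [Fin.prod_univ_castSucc, Fin.snoc_castSucc, Fin.snoc_last, eexp_const_mul]
    refine (eexp_mono fun D hD => ?_).trans (ih (by omega))
    exact mul_le_of_le_one_right' (hf n (by omega) D hD)

/-- Consistency of the data laws: it moves events about the data of the `n`-th iterate to the common
space of `K` episodes. -/
lemma eexp_firstEpisodes {K n : ℕ} (hn : n ≤ K) (F : (Fin n → Traj M) → ℝ≥0∞) :
    eexp (dataLaw M μ K) (fun D => F (firstEpisodes D n hn)) = eexp (dataLaw M μ n) F := by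
  induction K with
  | zero =>
    obtain rfl : n = 0 := by omega
    rfl
  | succ K ih =>
    rcases Nat.le_succ_iff.1 hn with h | rfl
    · rw [eexp_dataLaw_succ, ← ih h]
      refine eexp_congr fun D _ => ?_
      have : ∀ τ : Traj M, firstEpisodes (Fin.snoc (α := fun _ => Traj M) D τ) n hn =
          firstEpisodes D n h := by
        intro τ
        funext i
        have e : Fin.castLE hn i = Fin.castSucc (Fin.castLE h i) := rfl
        simp only [firstEpisodes, e, Fin.snoc_castSucc]
      simp only [this, eexp_const]
    · rfl

lemma firstEpisodes_mem_support {K n : ℕ} (hn : n ≤ K) {D : Fin K → Traj M}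
    (hD : D ∈ (dataLaw M μ K).support) :
    firstEpisodes D n hn ∈ (dataLaw M μ n).support :=
  mem_support_of_eexp_comp (fun F => eexp_firstEpisodes μ hn F) hD

lemma forall_of_mem_support_dataLaw {K : ℕ} {p : Traj M → Prop}
    (hp : ∀ n < K, ∀ D ∈ (dataLaw M μ n).support, ∀ τ ∈ (trajLaw M (μ n D)).support, p τ)
    {n : ℕ} (hn : n ≤ K) {D : Fin n → Traj M} (hD : D ∈ (dataLaw M μ n).support) (t : Fin n) :
    p (D t) := by
  induction n with
  | zero => exact t.elim0
  | succ n ih =>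
    simp only [dataLaw, PMF.mem_support_bind_iff, PMF.support_pure, Set.mem_singleton_iff] at hD
    obtain ⟨D', hD', τ, hτ, rfl⟩ := hD
    refine Fin.lastCases ?_ (fun i => ?_) t
    · simpa using hp n (by omega) D' hD' τ hτ
    · simpa using ih (by omega) hD' i

lemma mem_support_pairOcc_of_trajLaw {π : Policy S A} {τ : Traj M}
    (hτ : τ ∈ (trajLaw M π).support) (h : Fin M.H) : τ h ∈ (pairOcc M π h).support :=
  mem_support_of_eexp_comp (fun F => eexp_prefixLaw_coord M π h F) hτ

end Laws

/-! ### A uniform bound for centred sums over a finite set of covariates -/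

section Uniform

variable {Y : Type*} {n m : ℕ}

/-- The centred value of `V` at a draw `s` from `Q y`. -/
noncomputable def noise (Q : Y → PMF S) (V : S → ℝ) (y : Y) (s : S) : ℝ := V s - pexp (Q y) V

lemma abs_noise_le {Q : Y → PMF S} {V : S → ℝ} (hV : ∀ s, 0 ≤ V s ∧ V s ≤ 1) (y : Y) (s : S) :
    |noise Q V y s| ≤ 1 := by
  have := pexp_mem_Icc (p := Q y) hV
  rw [noise, abs_le]
  constructor <;> linarith [(hV s).1, (hV s).2, this.1, this.2]

lemma indicator_mem_Icc (E : Set S) (s : S) :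
    0 ≤ E.indicator (1 : S → ℝ) s ∧ E.indicator (1 : S → ℝ) s ≤ 1 := by
  by_cases h : s ∈ E <;> simp [h]

/-- The function on `X` with values in the grid `{j / m - 1 | j ≤ 2 m}` encoded by `c`, extended
by zero. -/
noncomputable def gridFun (X : Finset Y) (c : X → Fin (2 * m + 1)) (y : Y) : ℝ :=
  open Classical in if h : y ∈ X then (c ⟨y, h⟩ : ℝ) / m - 1 else 0

lemma abs_gridFun_le (X : Finset Y) (c : X → Fin (2 * m + 1)) (y : Y) :
    |gridFun X c y| ≤ 1 := by
  rw [gridFun]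
  split_ifs with h
  · rcases Nat.eq_zero_or_pos m with rfl | hm
    · simp
    · have hm' : (0 : ℝ) < m := by exact_mod_cast hm
      have h1 : ((c ⟨y, h⟩ : ℕ) : ℝ) ≤ 2 * m := by
        exact_mod_cast Nat.lt_succ_iff.1 (c ⟨y, h⟩).isLt
      have h2 : ((c ⟨y, h⟩ : ℕ) : ℝ) / m ≤ 2 := by rwa [div_le_iff₀ hm']
      have h3 : 0 ≤ ((c ⟨y, h⟩ : ℕ) : ℝ) / m := by positivity
      rw [abs_le]
      constructor <;> linarith
  · simp

/-- The target `e / 2` is the pointwise maximizer of `c * e - c ^ 2`, the penalized sum tested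
later. Rounding down to the grid costs at most one mesh width. -/
lemma exists_gridFun_near (X : Finset Y) (hm : 0 < m) (e : Y → ℝ) (he : ∀ y, |e y| ≤ 1) :
    ∃ c : X → Fin (2 * m + 1), ∀ y ∈ X, |gridFun X c y - e y / 2| ≤ 1 / m := by
  have hm' : (0 : ℝ) < m := by exact_mod_cast hm
  have hnn : ∀ y, 0 ≤ m * (e y / 2 + 1) := fun y =>
    mul_nonneg hm'.le (by linarith [(abs_le.1 (he y)).1])
  refine ⟨fun y => ⟨⌊m * (e y / 2 + 1)⌋₊, ?_⟩, fun y hy => ?_⟩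
  · rw [Nat.floor_lt (hnn y)]
    push_cast
    nlinarith [(abs_le.1 (he y)).2]
  · rw [gridFun, dif_pos hy]
    have h1 := Nat.floor_le (hnn y)
    have h2 := Nat.lt_floor_add_one (m * (e y / 2 + 1))
    have h3 : (⌊m * (e y / 2 + 1)⌋₊ : ℝ) / m - 1 - e y / 2 =
        (⌊m * (e y / 2 + 1)⌋₊ - m * (e y / 2 + 1)) / m := by
      field_simp
      ring
    simp only [h3]
    rw [abs_div, abs_of_pos hm']
    gcongr
    rw [abs_le]
    constructor <;> linarith

/-- Averages over the fibres of `y`. -/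
lemma exists_fiber_average (y : Fin n → Y) (η : Fin n → ℝ) (hη : ∀ t, |η t| ≤ 1) :
    ∃ e : Y → ℝ, (∀ x, |e x| ≤ 1) ∧
      ∀ g : Y → ℝ, ∑ t, g (y t) * η t = ∑ t, g (y t) * e (y t) := by
  classical
  refine ⟨fun x => (∑ t with y t = x, η t) / (Finset.univ.filter fun t => y t = x).card,
    fun x => ?_, fun g => ?_⟩
  · rw [abs_div, Nat.abs_cast]
    refine div_le_one_of_le₀ ?_ (Nat.cast_nonneg _)
    refine (Finset.abs_sum_le_sum_abs _ _).trans ?_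
    refine (Finset.sum_le_sum fun t _ => hη t).trans ?_
    simp
  · rw [← Finset.sum_fiberwise_of_maps_to (s := Finset.univ) (t := Finset.univ.image y) (g := y)
      (fun t ht => Finset.mem_image_of_mem y ht),
      ← Finset.sum_fiberwise_of_maps_to (s := Finset.univ) (t := Finset.univ.image y) (g := y)
      (fun t ht => Finset.mem_image_of_mem y ht) (f := fun t => g (y t) * _)]
    refine Finset.sum_congr rfl fun x hx => ?_
    obtain ⟨t0, -, rfl⟩ := Finset.mem_image.1 hx
    have hcard : ((Finset.univ.filter fun t => y t = y t0).card : ℝ) ≠ 0 := by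
      rw [Nat.cast_ne_zero, Finset.card_ne_zero]
      exact ⟨t0, by simp⟩
    have h1 : ∑ t with y t = y t0, g (y t) * η t = g (y t0) * ∑ t with y t = y t0, η t := by
      rw [Finset.mul_sum]
      exact Finset.sum_congr rfl fun t ht => by rw [(Finset.mem_filter.1 ht).2]
    have h2 : ∀ f : Y → ℝ, ∑ t with y t = y t0, f (y t) =
        (Finset.univ.filter fun t => y t = y t0).card * f (y t0) := by
      intro f
      rw [← nsmul_eq_mul, ← Finset.sum_const]
      exact Finset.sum_congr rfl fun t ht => by rw [(Finset.mem_filter.1 ht).2]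
    rw [h1]
    refine Eq.trans ?_ (h2 fun x => g x * ((∑ t with y t = x, η t) /
      (Finset.univ.filter fun t => y t = x).card)).symm
    field_simp

/-- A bound for the penalized sums with coefficients in the grid gives a bound for all
coefficients. -/
lemma abs_sum_mul_le_of_grid (X : Finset Y) (hm : 0 < m) (hn : n ≤ m) (y : Fin n → Y)
    (hy : ∀ t, y t ∈ X) (η : Fin n → ℝ) (hη : ∀ t, |η t| ≤ 1) {L : ℝ}
    (h : ∀ c : X → Fin (2 * m + 1),
      ∑ t, (gridFun X c (y t) * η t - gridFun X c (y t) ^ 2) ≤ L) (g : Y → ℝ) :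
    |∑ t, g (y t) * η t| ≤ √(4 * (L + 1)) * √(∑ t, g (y t) ^ 2) := by
  have hm' : (0 : ℝ) < m := by exact_mod_cast hm
  obtain ⟨e, he, hsum⟩ := exists_fiber_average y η hη
  obtain ⟨c, hc⟩ := exists_gridFun_near X hm e he
  -- Since `c * e - c ^ 2 = e ^ 2 / 4 - (c - e / 2) ^ 2`, the grid point near `e / 2` bounds the sum
  -- of `e ^ 2 / 4` by `L + n / m ^ 2`, hence by `L + 1` because `n ≤ m`. One test thus controls the
  -- fibre averages, and Cauchy–Schwarz then handles every `g`.
  have h1 : ∑ t, e (y t) ^ 2 ≤ 4 * (L + 1) := by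
    have h2 := h c
    rw [Finset.sum_sub_distrib, hsum, ← Finset.sum_sub_distrib] at h2
    have h3 : ∑ t, (e (y t) ^ 2 / 4 - 1 / (m : ℝ) ^ 2) ≤ L := by
      refine (Finset.sum_le_sum fun t _ => ?_).trans h2
      have h4 := sq_le_sq' (abs_le.1 (hc (y t) (hy t))).1 (abs_le.1 (hc (y t) (hy t))).2
      rw [div_pow, one_pow] at h4
      nlinarith
    rw [Finset.sum_sub_distrib, ← Finset.sum_div, Finset.sum_const, Finset.card_univ,
      Fintype.card_fin, nsmul_eq_mul, mul_one_div] at h3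
    have h5 : (n : ℝ) / (m : ℝ) ^ 2 ≤ 1 := by
      have hnm : (n : ℝ) ≤ m := by exact_mod_cast hn
      have hm1 : (1 : ℝ) ≤ m := by exact_mod_cast hm
      rw [div_le_one (by positivity)]
      nlinarith
    linarith
  rw [hsum, mul_comm, ← Real.sqrt_mul (Finset.sum_nonneg fun t _ => sq_nonneg _)]
  refine Real.abs_le_sqrt ((Finset.sum_mul_sq_le_sq_mul_sq _ _ _).trans ?_)
  exact mul_le_mul_of_nonneg_left h1 (Finset.sum_nonneg fun t _ => sq_nonneg _)

/-- A sum that is linear in `V` is at most its maximum over indicators. -/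
lemma exists_indicator_sum_le [DecidableEq S] (R : Finset S) (Q : Y → PMF S) (y : Fin n → Y)
    (hQ : ∀ t, (Q (y t)).support ⊆ R) (s : Fin n → S) (hs : ∀ t, s t ∈ R) (g : Y → ℝ) {V : S → ℝ}
    (hV : ∀ s, 0 ≤ V s ∧ V s ≤ 1) :
    ∃ E ⊆ R, ∑ t, g (y t) * noise Q V (y t) (s t) ≤
      ∑ t, g (y t) * noise Q ((E : Set S).indicator 1) (y t) (s t) := by
  classical
  let c : S → ℝ := fun x => ∑ t, g (y t) * ((if s t = x then 1 else 0) - (Q (y t) x).toReal)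
  have key : ∀ W : S → ℝ, ∑ t, g (y t) * noise Q W (y t) (s t) = ∑ x ∈ R, W x * c x := by
    intro W
    simp only [c, Finset.mul_sum]
    rw [Finset.sum_comm]
    refine Finset.sum_congr rfl fun t _ => ?_
    have h1 : W (s t) = ∑ x ∈ R, W x * (if s t = x then 1 else 0) := by
      simp [hs t]
    have h2 : pexp (Q (y t)) W = ∑ x ∈ R, W x * (Q (y t) x).toReal := by
      rw [pexp, tsum_eq_sum (s := R) fun x hx => ?_]
      · exact Finset.sum_congr rfl fun x _ => mul_comm _ _
      · rw [(PMF.apply_eq_zero_iff _ _).2 fun h => hx (hQ t h)]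
        simp
    rw [noise, h1, h2, ← Finset.sum_sub_distrib, Finset.mul_sum]
    exact Finset.sum_congr rfl fun x _ => by ring
  -- The sum equals `∑ W x * c x`, so over `W` with values in `[0, 1]` it is largest at the
  -- indicator of the positive coefficients.
  refine ⟨R.filter fun x => 0 < c x, Finset.filter_subset _ _, ?_⟩
  rw [key, key]
  refine Finset.sum_le_sum fun x hx => ?_
  by_cases hc : 0 < c x
  · rw [Set.indicator_of_mem (by simp [hx, hc])]
    exact mul_le_mul_of_nonneg_right (hV x).2 hc.le
  · rw [Set.indicator_of_notMem (by simp [hc]), zero_mul]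
    exact mul_nonpos_of_nonneg_of_nonpos (hV x).1 (not_lt.1 hc)

/-- Finitely many tests suffice for all `g` and all `V`, including those chosen from the data:
linearity reduces `V` to indicators, the grid handles `g`, and scaling by `b` and changing the sign
of `g` give the general two-sided bound. -/
lemma abs_sum_noise_le (X : Finset Y) (R : Finset S) (Q : Y → PMF S)
    (hQ : ∀ x ∈ X, (Q x).support ⊆ R) (hm : 0 < m) (hn : n ≤ m) (y : Fin n → Y)
    (hy : ∀ t, y t ∈ X) (s : Fin n → S) (hs : ∀ t, s t ∈ R) {L : ℝ}
    (h : ∀ c : X → Fin (2 * m + 1), ∀ E ⊆ R,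
      ∑ t, (gridFun X c (y t) * noise Q ((E : Set S).indicator 1) (y t) (s t) -
        gridFun X c (y t) ^ 2) ≤ L) (g : Y → ℝ) {V : S → ℝ} {b : ℝ} (hb : 0 ≤ b)
    (hV : ∀ s, 0 ≤ V s ∧ V s ≤ b) :
    |∑ t, g (y t) * noise Q V (y t) (s t)| ≤ b * √(4 * (L + 1)) * √(∑ t, g (y t) ^ 2) := by
  classical
  have unit : ∀ (g : Y → ℝ) (W : S → ℝ), (∀ s, 0 ≤ W s ∧ W s ≤ 1) →
      ∑ t, g (y t) * noise Q W (y t) (s t) ≤ √(4 * (L + 1)) * √(∑ t, g (y t) ^ 2) := by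
    intro g W hW
    obtain ⟨E, hE, hle⟩ := exists_indicator_sum_le R Q y (fun t => hQ _ (hy t)) s hs g hW
    refine hle.trans ((le_abs_self _).trans ?_)
    exact abs_sum_mul_le_of_grid X hm hn y hy _
      (fun t => abs_noise_le (indicator_mem_Icc _) _ _) (fun c => h c E hE) g
  have pos : ∀ g : Y → ℝ, ∑ t, g (y t) * noise Q V (y t) (s t) ≤
      b * √(4 * (L + 1)) * √(∑ t, g (y t) ^ 2) := by
    intro g
    have hW : ∀ s, 0 ≤ b⁻¹ * V s ∧ b⁻¹ * V s ≤ 1 := fun s => by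
      refine ⟨mul_nonneg (inv_nonneg.2 hb) (hV s).1, ?_⟩
      rw [inv_mul_eq_div]
      exact div_le_one_of_le₀ (hV s).2 hb
    have hVW : ∀ y s, noise Q V y s = b * noise Q (fun s => b⁻¹ * V s) y s := by
      intro y s
      rw [noise, noise, pexp_const_mul, ← mul_sub, ← mul_assoc]
      -- For `b = 0` the rescaling by `b⁻¹` is degenerate, but then `V` vanishes.
      rcases hb.eq_or_lt with rfl | hb'
      · have h0 : V = fun _ => 0 := funext fun s => le_antisymm (hV s).2 (hV s).1
        simp [h0, pexp_const]
      · rw [mul_inv_cancel₀ hb'.ne', one_mul]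
    calc ∑ t, g (y t) * noise Q V (y t) (s t)
        = b * ∑ t, g (y t) * noise Q (fun s => b⁻¹ * V s) (y t) (s t) := by
          rw [Finset.mul_sum]
          exact Finset.sum_congr rfl fun t _ => by rw [hVW]; ring
      _ ≤ b * (√(4 * (L + 1)) * √(∑ t, g (y t) ^ 2)) :=
          mul_le_mul_of_nonneg_left (unit g _ hW) hb
      _ = _ := by ring
  rw [abs_le]
  refine ⟨?_, pos g⟩
  have := pos fun x => -g x
  simp only [neg_mul, Finset.sum_neg_distrib, neg_sq] at this
  linarith

end Uniform

/-! ### Concentration -/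

section Concentration

/-- One step of the supermartingale: `exp x ≤ 1 + x + x ^ 2` for `|x| ≤ 1`, the linear term is
centred, and the penalty `g ^ 2` absorbs the rest through `1 + g ^ 2 ≤ exp (g ^ 2)`. -/
lemma eexp_exp_noise_le {Y : Type*} (Q : Y → PMF S) {V : S → ℝ} (hV : ∀ s, 0 ≤ V s ∧ V s ≤ 1)
    {g : ℝ} (hg : |g| ≤ 1) (y : Y) :
    eexp (Q y) (fun s => ENNReal.ofReal (Real.exp (g * noise Q V y s - g ^ 2))) ≤ 1 := by
  have hab := fun s => abs_noise_le (Q := Q) hV y s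
  have hp : ∀ s, |g * noise Q V y s| ≤ 1 := fun s => by
    rw [abs_mul]; exact mul_le_one₀ hg (abs_nonneg _) (hab s)
  have hbound : ∀ s, Real.exp (g * noise Q V y s - g ^ 2) ≤
      ((1 + g ^ 2) + g * noise Q V y s) * Real.exp (-g ^ 2) := by
    intro s
    rw [sub_eq_add_neg, Real.exp_add]
    refine mul_le_mul_of_nonneg_right ?_ (Real.exp_pos _).le
    have h1 := (abs_le.1 (Real.abs_exp_sub_one_sub_id_le (hp s))).2
    have h2 : (g * noise Q V y s) ^ 2 ≤ g ^ 2 := by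
      rw [mul_pow]
      exact mul_le_of_le_one_right (sq_nonneg _) ((sq_le_one_iff_abs_le_one _).2 (hab s))
    linarith
  have hnn : ∀ s, 0 ≤ ((1 + g ^ 2) + g * noise Q V y s) * Real.exp (-g ^ 2) := fun s =>
    (Real.exp_pos _).le.trans (hbound s)
  refine (eexp_mono fun s _ => ENNReal.ofReal_le_ofReal (hbound s)).trans ?_
  rw [eexp_ofReal (Q y) (c := (1 + g ^ 2 + 1) * Real.exp (-g ^ 2)) hnn fun s =>
    mul_le_mul_of_nonneg_right (by linarith [(abs_le.1 (hp s)).2]) (Real.exp_pos _).le]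
  have hb : ∀ s, |V s| ≤ 1 := fun s => by rw [abs_of_nonneg (hV s).1]; exact (hV s).2
  have hmean : pexp (Q y) (noise Q V y) = 0 := by
    have : noise Q V y = fun s => V s + -pexp (Q y) V := rfl
    rw [this, pexp_add (Q y) hb (fun _ => le_rfl), pexp_const, add_neg_cancel]
  have hcomp : pexp (Q y) (fun s => ((1 + g ^ 2) + g * noise Q V y s) * Real.exp (-g ^ 2)) =
      (1 + g ^ 2) * Real.exp (-g ^ 2) := by
    simp only [mul_comm _ (Real.exp (-g ^ 2))]
    rw [pexp_const_mul, pexp_add (Q y) (fun _ => le_rfl) hp, pexp_const, pexp_const_mul, hmean]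
    ring
  rw [hcomp, ← ENNReal.ofReal_one]
  refine ENNReal.ofReal_le_ofReal ?_
  rw [Real.exp_neg, ← div_eq_mul_inv]
  refine div_le_one_of_le₀ ?_ (Real.exp_pos _).le
  linarith [Real.add_one_le_exp (g ^ 2)]

variable {M : MDP S A} {μ : Collector M} {K : ℕ}

/-- The transition law at stage `h` as a function of the state-action pair. -/
def step (M : MDP S A) (h : ℕ) (x : S × A) : PMF S := M.P h x.1 x.2

lemma eexp_trajLaw_noise_le (π : Policy S A) (h : ℕ) (hh : h + 1 < M.H) {V : S → ℝ}
    (hV : ∀ s, 0 ≤ V s ∧ V s ≤ 1) {g : S × A → ℝ} (hg : ∀ x, |g x| ≤ 1) :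
    eexp (trajLaw M π) (fun τ => ENNReal.ofReal (Real.exp
      (g (τ ⟨h, by omega⟩) * noise (step M h) V (τ ⟨h, by omega⟩) (τ ⟨h + 1, hh⟩).1 -
        g (τ ⟨h, by omega⟩) ^ 2))) ≤ 1 := by
  rw [trajLaw, eexp_prefixLaw_pair M π h hh fun x s =>
    ENNReal.ofReal (Real.exp (g x * noise (step M h) V x s - g x ^ 2))]
  refine (eexp_mono fun x _ => ?_).trans (eexp_const _ 1).le
  exact eexp_exp_noise_le (step M h) hV (hg x) x

lemma prod_ofReal_exp {n : ℕ} (f : Fin n → ℝ) :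
    ∏ t, ENNReal.ofReal (Real.exp (f t)) = ENNReal.ofReal (Real.exp (∑ t, f t)) := by
  rw [Real.exp_sum, ENNReal.ofReal_prod_of_nonneg fun t _ => (Real.exp_pos _).le]

/-- A union bound for finitely many exponential supermartingales. -/
lemma toOuterMeasure_exists_le {X ι : Type*} {p : PMF X} (T : Finset ι) (f : ι → X → ℝ)
    (hf : ∀ i ∈ T, eexp p (fun x => ENNReal.ofReal (Real.exp (f i x))) ≤ 1) {N δ : ℝ}
    (hN : (T.card : ℝ) ≤ N) (hN0 : 0 < N) (hδ : 0 < δ) :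
    p.toOuterMeasure {x | ∃ i ∈ T, Real.log (N / δ) < f i x} ≤ ENNReal.ofReal δ := by
  have h1 : eexp p (fun x => ∑ i ∈ T, ENNReal.ofReal (Real.exp (f i x))) ≤ ENNReal.ofReal N := by
    rw [eexp_sum]
    refine (Finset.sum_le_sum hf).trans ?_
    rw [Finset.sum_const, nsmul_one, ← ENNReal.ofReal_natCast]
    exact ENNReal.ofReal_le_ofReal hN
  -- On the event one of the exponentials exceeds `N / δ`, so Markov's inequality applies to their
  -- sum, whose expectation is at most `N`.
  refine (toOuterMeasure_le_of_one_le (δ := ENNReal.ofReal (δ / N)) h1 ?_).trans ?_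
  · rintro x - ⟨i, hi, hx⟩
    have h2 : 1 ≤ Real.exp (f i x) * (δ / N) := by
      have := Real.exp_lt_exp.2 hx
      rw [Real.exp_log (by positivity)] at this
      calc (1 : ℝ) = N / δ * (δ / N) := by field_simp
        _ ≤ _ := by gcongr
    calc (1 : ℝ≥0∞) ≤ ENNReal.ofReal (Real.exp (f i x) * (δ / N)) := by
          rw [← ENNReal.ofReal_one]; exact ENNReal.ofReal_le_ofReal h2
      _ = ENNReal.ofReal (Real.exp (f i x)) * ENNReal.ofReal (δ / N) :=
          ENNReal.ofReal_mul (Real.exp_pos _).le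
      _ ≤ _ := by
          gcongr
          exact Finset.single_le_sum (f := fun i => ENNReal.ofReal (Real.exp (f i x)))
            (fun _ _ => zero_le) hi
  · rw [← ENNReal.ofReal_mul hN0.le]
    exact ENNReal.ofReal_le_ofReal (by field_simp; rfl)

/-- With high probability the penalized noise sums at stage `h` are uniformly bounded. -/
lemma toOuterMeasure_noise_le (h : ℕ) (hh : h + 1 < M.H) (X : Finset (S × A)) (R : Finset S)
    {n : ℕ} (m : ℕ) {δ : ℝ} (hδ : 0 < δ) :
    (dataLaw M μ n).toOuterMeasure {D | ∃ c : X → Fin (2 * m + 1), ∃ E ⊆ R,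
      Real.log (((2 * m + 1) ^ X.card * 2 ^ R.card : ℕ) / δ) <
        ∑ t, (gridFun X c (D t ⟨h, by omega⟩) * noise (step M h) ((E : Set S).indicator 1)
          (D t ⟨h, by omega⟩) (D t ⟨h + 1, hh⟩).1 - gridFun X c (D t ⟨h, by omega⟩) ^ 2)} ≤
      ENNReal.ofReal δ := by
  classical
  refine le_trans (MeasureTheory.measure_mono ?_) (toOuterMeasure_exists_le (p := dataLaw M μ n)
    ((Finset.univ : Finset (X → Fin (2 * m + 1))) ×ˢ R.powerset)
    (fun i D => ∑ t, (gridFun X i.1 (D t ⟨h, by omega⟩) *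
      noise (step M h) ((i.2 : Set S).indicator 1)
        (D t ⟨h, by omega⟩) (D t ⟨h + 1, hh⟩).1 - gridFun X i.1 (D t ⟨h, by omega⟩) ^ 2))
    (fun i _ => ?_) (N := ((2 * m + 1) ^ X.card * 2 ^ R.card : ℕ)) ?_ ?_ hδ)
  · rintro D ⟨c, E, hE, hD⟩
    exact ⟨(c, E), by simp [hE], hD⟩
  · simp only [← prod_ofReal_exp]
    exact eexp_dataLaw_prod_le (K := n) μ _ (fun n _ D _ =>
      eexp_trajLaw_noise_le (μ n D) h hh (indicator_mem_Icc _)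
        (abs_gridFun_le X i.1)) le_rfl
  · simp [Finset.card_product]
  · exact_mod_cast Nat.pos_of_ne_zero (by positivity)

/-- The number of visits to `x` at stage `h`. -/
noncomputable def visits {n : ℕ} (D : Fin n → Traj M) (h : Fin M.H) (x : S × A) : Finset (Fin n) :=
  open Classical in Finset.univ.filter fun t => D t h = x

/-- A multiplicative Chernoff step: `exp (-1) < 1 / 2` makes the mean of `exp (-indicator)` at most
`1 - k / 2 ≤ exp (-k / 2)`. Half of the expected visits are given away to keep the deviation term
purely logarithmic. -/
lemma eexp_trajLaw_visit_le (π : Policy S A) (h : Fin M.H) (x : S × A) {k : ℝ}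
    (hk : k ≤ (pairOcc M π h x).toReal) :
    eexp (trajLaw M π) (fun τ => ENNReal.ofReal (Real.exp
      (k / 2 - ({x} : Set (S × A)).indicator 1 (τ h)))) ≤ 1 := by
  have e1 := Real.exp_neg_one_lt_half
  rw [trajLaw, eexp_prefixLaw_coord M π h fun y =>
    ENNReal.ofReal (Real.exp (k / 2 - ({x} : Set (S × A)).indicator 1 y))]
  have hfun : ∀ y : S × A, Real.exp (k / 2 - ({x} : Set (S × A)).indicator 1 y) =
      Real.exp (k / 2) * (1 + (Real.exp (-1) - 1) * ({x} : Set (S × A)).indicator 1 y) := by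
    intro y
    rw [sub_eq_add_neg, Real.exp_add]
    by_cases hy : y = x <;> simp [hy]
  have hle : ∀ y : S × A, Real.exp (k / 2 - ({x} : Set (S × A)).indicator 1 y) ≤
      Real.exp (k / 2) := fun y =>
    Real.exp_le_exp.2 (by linarith [(indicator_mem_Icc ({x} : Set (S × A)) y).1])
  rw [eexp_ofReal _ (fun y => (Real.exp_pos _).le) hle]
  have hb : ∀ y, |(Real.exp (-1) - 1) * ({x} : Set (S × A)).indicator (1 : S × A → ℝ) y| ≤
      |Real.exp (-1) - 1| := fun y => by
    by_cases hy : y = x <;> simp [hy]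
  simp only [hfun]
  rw [pexp_const_mul, pexp_add _ (fun _ => le_rfl) hb, pexp_const, pexp_const_mul, pexp_indicator,
    prob, PMF.toOuterMeasure_apply_singleton, ← ENNReal.ofReal_one]
  refine ENNReal.ofReal_le_ofReal ?_
  set p := (pairOcc M π h x).toReal
  have hp : 0 ≤ p := ENNReal.toReal_nonneg
  calc Real.exp (k / 2) * (1 + (Real.exp (-1) - 1) * p)
      ≤ Real.exp (k / 2) * Real.exp (-(k / 2)) := by
        gcongr
        have := Real.add_one_le_exp (-(k / 2))
        nlinarith
    _ = 1 := by rw [← Real.exp_add, add_neg_cancel, Real.exp_zero]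

/-- With high probability all pairs in `X` are visited often. -/
lemma toOuterMeasure_visits_le (h : Fin M.H) (X : Finset (S × A)) (hX : X.Nonempty) {k : ℝ}
    (hk : ∀ n < K, ∀ D ∈ (dataLaw M μ n).support, ∀ x ∈ X,
      k ≤ (pairOcc M (μ n D) h x).toReal) {n : ℕ} (hn : n ≤ K) {δ : ℝ} (hδ : 0 < δ) :
    (dataLaw M μ n).toOuterMeasure {D | ∃ x ∈ X,
      Real.log (X.card / δ) < n * (k / 2) - (visits D h x).card} ≤ ENNReal.ofReal δ := by
  classical
  have hsum : ∀ (D : Fin n → Traj M) (x : S × A), (n : ℝ) * (k / 2) - (visits D h x).card =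
      ∑ t, (k / 2 - ({x} : Set (S × A)).indicator 1 (D t h)) := by
    intro D x
    rw [Finset.sum_sub_distrib, Finset.sum_const, Finset.card_univ, Fintype.card_fin,
      nsmul_eq_mul]
    congr 1
    simp only [visits, Set.indicator_apply, Set.mem_singleton_iff, Pi.one_apply]
    rw [Finset.sum_boole]
  refine toOuterMeasure_exists_le (p := dataLaw M μ n) X
    (fun x D => (n : ℝ) * (k / 2) - (visits D h x).card) (fun x hx => ?_) le_rfl
    (by exact_mod_cast hX.card_pos) hδ
  simp only [hsum, ← prod_ofReal_exp]
  exact eexp_dataLaw_prod_le μ _ (fun n hn D hD => eexp_trajLaw_visit_le (μ n D) h x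
    (hk n hn D hD x hx)) hn

end Concentration

/-! ### Linear mixture models -/

section LinearMixture

variable {M : MDP S A} {d : ℕ} {φ : S → A → S → EuclideanSpace ℝ (Fin d)} {Cw : ℝ}

lemma abs_le_norm_euclidean (x : EuclideanSpace ℝ (Fin d)) (i : Fin d) : |x i| ≤ ‖x‖ := by
  simpa using PiLp.norm_apply_le x i

lemma IsLinearMixture.norm_sum_le (hM : IsLinearMixture M φ Cw) (s : S) (a : A) (T : Finset S) :
    ‖∑ s' ∈ T, φ s a s'‖ ≤ 1 := by
  classical
  have h := hM.feature ((T : Set S).indicator 1) (indicator_mem_Icc _) s a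
  rw [featV, tsum_eq_sum (s := T) fun s' hs' => by simp [hs']] at h
  rwa [Finset.sum_congr rfl fun s' hs' => by
    rw [Set.indicator_of_mem (Finset.mem_coe.2 hs'), Pi.one_apply, one_smul]] at h

/-- Every finite partial sum is bounded by one, even after selecting the terms of one sign.
Splitting by sign bounds the absolute sums by two. -/
lemma IsLinearMixture.summable_coord (hM : IsLinearMixture M φ Cw) (s : S) (a : A) (i : Fin d) :
    Summable fun s' => |φ s a s' i| := by
  classical
  have hT : ∀ T : Finset S, |∑ s' ∈ T, φ s a s' i| ≤ 1 := fun T => by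
    have h := (abs_le_norm_euclidean (∑ s' ∈ T, φ s a s') i).trans (hM.norm_sum_le s a T)
    rwa [WithLp.ofLp_sum, Finset.sum_apply] at h
  refine summable_of_sum_le (c := 2) (fun _ => abs_nonneg _) fun T => ?_
  rw [← Finset.sum_filter_add_sum_filter_not T (fun s' => 0 ≤ φ s a s' i)]
  have h1 : ∑ s' ∈ T.filter (fun s' => 0 ≤ φ s a s' i), |φ s a s' i| =
      ∑ s' ∈ T.filter (fun s' => 0 ≤ φ s a s' i), φ s a s' i :=
    Finset.sum_congr rfl fun s' hs' => abs_of_nonneg (Finset.mem_filter.1 hs').2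
  have h2 : ∑ s' ∈ T.filter (fun s' => ¬ 0 ≤ φ s a s' i), |φ s a s' i| =
      -∑ s' ∈ T.filter (fun s' => ¬ 0 ≤ φ s a s' i), φ s a s' i := by
    rw [← Finset.sum_neg_distrib]
    exact Finset.sum_congr rfl fun s' hs' =>
      abs_of_neg (not_le.1 (Finset.mem_filter.1 hs').2)
  rw [h1, h2]
  linarith [(abs_le.1 (hT (T.filter fun s' => 0 ≤ φ s a s' i))).2,
    (abs_le.1 (hT (T.filter fun s' => ¬ 0 ≤ φ s a s' i))).1]

lemma IsLinearMixture.summable_featV (hM : IsLinearMixture M φ Cw) {V : S → ℝ} {b : ℝ}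
    (hV : ∀ s, |V s| ≤ b) (s : S) (a : A) : Summable fun s' => V s' • φ s a s' := by
  rw [← (PiLp.continuousLinearEquiv 2 ℝ fun _ : Fin d => ℝ).summable, Pi.summable]
  intro i
  refine Summable.of_norm_bounded ((hM.summable_coord s a i).mul_left b) fun s' => ?_
  simp only [PiLp.continuousLinearEquiv_apply, PiLp.smul_apply, smul_eq_mul, norm_mul,
    Real.norm_eq_abs]
  exact mul_le_mul_of_nonneg_right (hV s') (abs_nonneg _)

/-- The conditional expectation of a bounded `V` is linear in `φ_V`. -/
lemma IsLinearMixture.pexp_eq (hM : IsLinearMixture M φ Cw) {V : S → ℝ} {b : ℝ}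
    (hV : ∀ s, |V s| ≤ b) {P : PMF S} {w : EuclideanSpace ℝ (Fin d)} {s : S} {a : A}
    (hP : ∀ s', (P s').toReal = inner ℝ (φ s a s') w) :
    pexp P V = (featV φ V s a).ofLp ⬝ᵥ w.ofLp := by
  have h1 : (featV φ V s a).ofLp ⬝ᵥ w.ofLp = inner ℝ w (featV φ V s a) := by
    rw [EuclideanSpace.inner_eq_star_dotProduct, star_trivial]
  rw [h1, featV, ← innerSL_apply_apply ℝ,
    ContinuousLinearMap.map_tsum _ (hM.summable_featV hV s a), pexp]
  refine tsum_congr fun s' => ?_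
  rw [innerSL_apply_apply, inner_smul_right, real_inner_comm, ← hP, mul_comm]

lemma sqrt_dotProduct_self (w : EuclideanSpace ℝ (Fin d)) : √(w.ofLp ⬝ᵥ w.ofLp) = ‖w‖ := by
  rw [EuclideanSpace.norm_eq]
  simp [dotProduct, sq]

end LinearMixture

/-! ### The estimate of one stage -/

section Stage

lemma abs_clip_sub_le {x y u : ℝ} (h0 : 0 ≤ y) (hu : y ≤ u) :
    |max (min x u) 0 - y| ≤ |x - y| := by
  calc |max (min x u) 0 - y| = |max (min x u) 0 - max (min y u) 0| := by
        rw [min_eq_left hu, max_eq_left h0]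
    _ ≤ |min x u - min y u| := abs_sup_sub_sup_le_abs _ _ _
    _ ≤ |x - y| := abs_inf_sub_inf_le_abs _ _ _

variable {M : MDP S A} {d : ℕ} {φ : S → A → S → EuclideanSpace ℝ (Fin d)} {Cw : ℝ} {n : ℕ}
  {D : Fin n → Traj M} {β : ℝ}

lemma qHat_mem_Icc (h : Fin M.H) (V : S → ℝ) (s : S) (a : A) :
    0 ≤ qHat M φ 1 D β h V s a ∧ qHat M φ 1 D β h V s a ≤ (M.H : ℝ) - (h : ℕ) := by
  refine ⟨le_max_right _ _, max_le (min_le_right _ _) (sub_nonneg.2 ?_)⟩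
  exact_mod_cast h.isLt.le

/-- The estimated action values are close to the Bellman backup of the next value estimate. -/
lemma abs_qHat_sub_le (hM : IsLinearMixture M φ Cw) (hβ : 0 ≤ β) (h : Fin M.H) {V : S → ℝ}
    (hV : ∀ s, 0 ≤ V s ∧ V s ≤ (M.H : ℝ) - ((h : ℕ) + 1 : ℕ)) {c : ℝ} (hc : 0 ≤ c)
    (hη : ∀ hh : (h : ℕ) + 1 < M.H, ∀ g : S × A → ℝ,
      |∑ t, g (D t h) * noise (step M h) V (D t h) (D t ⟨(h : ℕ) + 1, hh⟩).1| ≤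
        c * √(∑ t, g (D t h) ^ 2)) {N : ℝ} (hN : 0 < N) {x : S × A}
    (hx : N ≤ (visits D h x).card) :
    |qHat M φ 1 D β h V x.1 x.2 - (M.r h x.1 x.2 + pexp (M.P h x.1 x.2) V)| ≤
      (c + Cw + β) / √N := by
  classical
  obtain ⟨w, hw⟩ := hM.transition
  obtain ⟨hwn, hwP⟩ := hw h h.isLt
  have hVb : ∀ s, |V s| ≤ (M.H : ℝ) - ((h : ℕ) + 1 : ℕ) := fun s => by
    rw [abs_of_nonneg (hV s).1]; exact (hV s).2
  have hP : ∀ y : S × A, pexp (step M h y) V = (featV φ V y.1 y.2).ofLp ⬝ᵥ (w h).ofLp :=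
    fun y => hM.pexp_eq hVb (hwP y.1 y.2)
  set v : Fin n → Fin d → ℝ := fun t => (featV φ V (D t h).1 (D t h).2).ofLp with hv
  set u := (featV φ V x.1 x.2).ofLp with hu
  set q := u ⬝ᵥ ((ridge v)⁻¹ *ᵥ u) with hq
  have hq0 : 0 ≤ q := ridge_quadForm_nonneg v u
  -- Each visit to `x` repeats its feature vector in the design, whatever `V` is.
  have hqN : √q ≤ 1 / √N := by
    rw [← Real.sqrt_one, ← Real.sqrt_div zero_le_one]
    refine Real.sqrt_le_sqrt ((le_div_iff₀ hN).2 ?_)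
    have := card_mul_ridge_quadForm_le v u (visits D h x) fun t ht => by
      rw [visits, Finset.mem_filter] at ht
      simp only [hv, hu, ht.2]
    rw [mul_comm]
    exact (mul_le_mul_of_nonneg_right hx hq0).trans this
  have herr : |u ⬝ᵥ wHat M φ 1 D h V - u ⬝ᵥ (w h).ofLp| ≤ (c + Cw) * √q := by
    refine abs_ridge_error_le v u (w h).ofLp (target M D h V)
      (fun t => target M D h V t - v t ⬝ᵥ (w h).ofLp) (fun t => by ring) hc
      ((sqrt_dotProduct_self _).trans_le hwn) ?_
    by_cases hh : (h : ℕ) + 1 < M.H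
    · have := hη hh fun y => (featV φ V y.1 y.2).ofLp ⬝ᵥ ((ridge v)⁻¹ *ᵥ u)
      refine le_trans (le_of_eq ?_) this
      congr 1
      refine Finset.sum_congr rfl fun t _ => ?_
      rw [noise, hP, target, dif_pos hh]
    -- At the last stage there is no next state in the data; both the target and the value to be
    -- predicted are zero, so there is no noise.
    · have hz : V = fun _ => 0 := by
        have hH : (M.H : ℝ) - ((h : ℕ) + 1 : ℕ) ≤ 0 := by
          rw [sub_nonpos]
          exact_mod_cast not_lt.1 hh
        exact funext fun s => le_antisymm ((hV s).2.trans hH) (hV s).1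
      have h0 : ∀ t, target M D h V t - v t ⬝ᵥ (w h).ofLp = 0 := by
        intro t
        rw [hv, ← hP, target, dif_neg hh, hz, pexp_const, sub_zero]
      simp only [h0, mul_zero, Finset.sum_const_zero, abs_zero]
      positivity
  have hCw : 0 ≤ Cw := (norm_nonneg _).trans hwn
  have hpe := pexp_mem_Icc (p := M.P h x.1 x.2) hV
  rw [qHat]
  refine (abs_clip_sub_le (add_nonneg (M.r_nonneg _ _ _) hpe.1) ?_).trans ?_
  · have := M.r_le_one h x.1 x.2
    have := hpe.2
    push_cast at this
    linarith
  · have hbonus : bonus M φ 1 D β h V x.1 x.2 = β * √q := rfl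
    have hPx : pexp (M.P h x.1 x.2) V = u ⬝ᵥ (w h).ofLp := hP x
    rw [hbonus, hPx]
    -- The bonus enters as one more error of the same order as the regression error.
    calc |M.r h x.1 x.2 + u ⬝ᵥ wHat M φ 1 D h V - β * √q -
          (M.r h x.1 x.2 + u ⬝ᵥ (w h).ofLp)|
        = |(u ⬝ᵥ wHat M φ 1 D h V - u ⬝ᵥ (w h).ofLp) - β * √q| := by ring_nf
      _ ≤ |u ⬝ᵥ wHat M φ 1 D h V - u ⬝ᵥ (w h).ofLp| + |β * √q| := abs_sub _ _
      _ ≤ (c + Cw) * √q + β * √q := by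
          rw [abs_of_nonneg (mul_nonneg hβ (Real.sqrt_nonneg q))]
          gcongr
      _ = (c + Cw + β) * √q := by ring
      _ ≤ (c + Cw + β) * (1 / √N) := by gcongr
      _ = _ := by ring

end Stage

/-! ### From Bellman errors to sub-optimality -/

section Bellman

variable {M : MDP S A} {π πs : Policy S A} {V : ℕ → S → ℝ} {Q : ℕ → S → A → ℝ} {Γ : ℕ → ℝ}

lemma sum_range_shift (Γ : ℕ → ℝ) (h j : ℕ) :
    ∑ i ∈ Finset.range (j + 1), Γ (h + i) = Γ h + ∑ i ∈ Finset.range j, Γ (h + 1 + i) := by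
  rw [Finset.sum_range_succ', add_zero, add_comm]
  congr 1
  exact Finset.sum_congr rfl fun i _ => by congr 1; omega

lemma abs_backup_le {V : S → ℝ} {c : ℝ} (hV : ∀ s, 0 ≤ V s ∧ V s ≤ c) (h : ℕ) (s : S) (a : A) :
    |M.r h s a + pexp (M.P h s a) V| ≤ 1 + c := by
  have h1 := pexp_mem_Icc (p := M.P h s a) hV
  rw [abs_of_nonneg (add_nonneg (M.r_nonneg _ _ _) h1.1)]
  exact add_le_add (M.r_le_one _ _ _) h1.2

lemma abs_valueFrom_le (π : Policy S A) (j h : ℕ) (s : S) : |valueFrom M π j h s| ≤ j := by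
  rw [abs_of_nonneg (valueFrom_mem_Icc M π j h s).1]
  exact (valueFrom_mem_Icc M π j h s).2

/-- Backward induction along the comparator: greediness passes from its action average of `Q` to
`V`. Errors are needed only at pairs the comparator visits, since the induction never leaves its
support. -/
lemma valueFrom_le_add {c : ℝ} (hV : ∀ h ≤ M.H, ∀ s, 0 ≤ V h s ∧ V h s ≤ c)
    (hQ : ∀ h < M.H, ∀ s a, |Q h s a| ≤ c)
    (hgreedy : ∀ h < M.H, ∀ s ∈ (stateOcc M πs h).support, pexp (πs h s) (Q h s) ≤ V h s)
    (herr : ∀ h < M.H, ∀ x ∈ (pairOcc M πs h).support,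
      |Q h x.1 x.2 - (M.r h x.1 x.2 + pexp (M.P h x.1 x.2) (V (h + 1)))| ≤ Γ h)
    (j h : ℕ) (hj : h + j = M.H) (s : S) (hs : s ∈ (stateOcc M πs h).support) :
    valueFrom M πs j h s ≤ V h s + ∑ i ∈ Finset.range j, Γ (h + i) := by
  induction j generalizing h s with
  | zero => simpa [valueFrom] using (hV h (by omega) s).1
  | succ j ih =>
    rw [valueFrom, sum_range_shift]
    refine (pexp_le_add (e := Γ h + ∑ i ∈ Finset.range j, Γ (h + 1 + i))
      (fun a => abs_backup_le (valueFrom_mem_Icc M πs j (h + 1)) h s a)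
      (hQ h (by omega) s) fun a ha => ?_).trans (add_le_add (hgreedy h (by omega) s hs) le_rfl)
    have hx : (s, a) ∈ (pairOcc M πs h).support := (mem_support_pairOcc M).2 ⟨hs, ha⟩
    have h1 := (abs_le.1 (herr h (by omega) (s, a) hx)).1
    have h2 := pexp_le_add (p := M.P h s a) (abs_valueFrom_le πs j (h + 1))
      (fun s' => by
        rw [abs_of_nonneg (hV (h + 1) (by omega) s').1]; exact (hV (h + 1) (by omega) s').2)
      fun s' hs' => ih (h + 1) (by omega) s' (mem_support_stateOcc_succ M hx hs')
    linarith

lemma le_valueFrom_add {c : ℝ} (hV : ∀ h ≤ M.H, ∀ s, 0 ≤ V h s ∧ V h s ≤ c)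
    (hVH : ∀ s, V M.H s = 0) (hQ : ∀ h < M.H, ∀ s a, |Q h s a| ≤ c)
    (hVQ : ∀ h < M.H, ∀ s, V h s = pexp (π h s) (Q h s))
    (herr : ∀ h < M.H, ∀ x ∈ (pairOcc M π h).support,
      |Q h x.1 x.2 - (M.r h x.1 x.2 + pexp (M.P h x.1 x.2) (V (h + 1)))| ≤ Γ h)
    (j h : ℕ) (hj : h + j = M.H) (s : S) (hs : s ∈ (stateOcc M π h).support) :
    V h s ≤ valueFrom M π j h s + ∑ i ∈ Finset.range j, Γ (h + i) := by
  induction j generalizing h s with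
  | zero =>
    obtain rfl : h = M.H := by omega
    simp [valueFrom, hVH]
  | succ j ih =>
    rw [valueFrom, sum_range_shift, hVQ h (by omega)]
    refine pexp_le_add (hQ h (by omega) s)
      (fun a => abs_backup_le (valueFrom_mem_Icc M π j (h + 1)) h s a) fun a ha => ?_
    have hx : (s, a) ∈ (pairOcc M π h).support := (mem_support_pairOcc M).2 ⟨hs, ha⟩
    have h1 := (abs_le.1 (herr h (by omega) (s, a) hx)).2
    have h2 := pexp_le_add (p := M.P h s a)
      (fun s' => by
        rw [abs_of_nonneg (hV (h + 1) (by omega) s').1]; exact (hV (h + 1) (by omega) s').2)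
      (abs_valueFrom_le π j (h + 1))
      fun s' hs' => ih (h + 1) (by omega) s' (mem_support_stateOcc_succ M hx hs')
    linarith

/-- Sub-optimality is at most twice the sum of the Bellman errors. -/
lemma subOpt_le_two_mul_sum {c : ℝ} (hopt : IsOptimal M πs)
    (hV : ∀ h ≤ M.H, ∀ s, 0 ≤ V h s ∧ V h s ≤ c)
    (hVH : ∀ s, V M.H s = 0) (hQ : ∀ h < M.H, ∀ s a, |Q h s a| ≤ c)
    (hVQ : ∀ h < M.H, ∀ s, V h s = pexp (π h s) (Q h s))
    (hgreedy : ∀ h < M.H, ∀ s ∈ (stateOcc M πs h).support, pexp (πs h s) (Q h s) ≤ V h s)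
    (herrs : ∀ h < M.H, ∀ x ∈ (pairOcc M πs h).support,
      |Q h x.1 x.2 - (M.r h x.1 x.2 + pexp (M.P h x.1 x.2) (V (h + 1)))| ≤ Γ h)
    (herr : ∀ h < M.H, ∀ x ∈ (pairOcc M π h).support,
      |Q h x.1 x.2 - (M.r h x.1 x.2 + pexp (M.P h x.1 x.2) (V (h + 1)))| ≤ Γ h) :
    subOpt M π ≤ 2 * ∑ h ∈ Finset.range M.H, Γ h := by
  have hV0 : ∀ s, |V 0 s| ≤ c := fun s => by
    rw [abs_of_nonneg (hV 0 (Nat.zero_le _) s).1]; exact (hV 0 (Nat.zero_le _) s).2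
  have h1 := pexp_le_add (p := M.init) (abs_valueFrom_le πs M.H 0) hV0 fun s hs =>
    valueFrom_le_add hV hQ hgreedy herrs M.H 0 (zero_add _) s hs
  have h2 := pexp_le_add (p := M.init) hV0 (abs_valueFrom_le π M.H 0) fun s hs =>
    le_valueFrom_add hV hVH hQ hVQ herr M.H 0 (zero_add _) s hs
  simp only [zero_add] at h1 h2
  rw [subOpt_eq_of_isOptimal M hopt, value, value]
  linarith

variable {d : ℕ} {φ : S → A → S → EuclideanSpace ℝ (Fin d)} {Cw : ℝ} {n : ℕ}
  {D : Fin n → Traj M} {β : ℝ} {B : ℕ → S → Set A}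

/-- Changing the maximizer at the single state `s` stays in the class, so the competitor has to be
supported only at `s`. This matters because the optimal policy is controlled only where it goes. -/
lemma IsGreedy.pexp_le {h : ℕ} {q : S → A → ℝ} {ρ : S → PMF A} (hρ : IsGreedy M B h q ρ) {s : S}
    {p : PMF A} (hp : p.support ⊆ B h s) : pexp p (q s) ≤ pexp (ρ s) (q s) := by
  classical
  have := hρ.2 (Function.update ρ s p) (fun s' hs' => by
    by_cases hss : s' = s
    · subst hss
      simpa using hp
    · simpa [Function.update_of_ne hss] using hρ.1 s' hs') s
  simpa using this

/-- The sub-optimality of an iterate computed from data in which the noise is small and all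
relevant pairs are visited often. -/
lemma IsIterate.subOpt_le (hM : IsLinearMixture M φ Cw) (hβ : 0 ≤ β)
    (hπ : IsIterate M φ 1 D B β π) (hopt : IsOptimal M πs)
    (hB : ∀ h < M.H, ∀ s ∈ (stateOcc M πs h).support, (πs h s).support ⊆ B h s)
    {X : ℕ → Set (S × A)} (hXs : ∀ h < M.H, (pairOcc M πs h).support ⊆ X h)
    (hX : ∀ h < M.H, (pairOcc M π h).support ⊆ X h) {c N : ℕ → ℝ} (hc : ∀ h, 0 ≤ c h)
    (hN : ∀ h < M.H, 0 < N h)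
    (hη : ∀ (h : ℕ) (hh : h + 1 < M.H) (g : S × A → ℝ) (V : S → ℝ),
      (∀ s, 0 ≤ V s ∧ V s ≤ (M.H : ℝ)) →
      |∑ t, g (D t ⟨h, by omega⟩) *
        noise (step M h) V (D t ⟨h, by omega⟩) (D t ⟨h + 1, hh⟩).1| ≤
        c h * √(∑ t, g (D t ⟨h, by omega⟩) ^ 2))
    (hvis : ∀ h : Fin M.H, ∀ x ∈ X h, N h ≤ (visits D h x).card) :
    subOpt M π ≤ 2 * ∑ h ∈ Finset.range M.H, (c h + Cw + β) / √(N h) := by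
  obtain ⟨V, hVH, hV⟩ := hπ
  have hVb : ∀ h ≤ M.H, ∀ s, 0 ≤ V h s ∧ V h s ≤ (M.H : ℝ) - h := by
    intro h hh s
    rcases hh.lt_or_eq with hlt | rfl
    · rw [(hV ⟨h, hlt⟩).2 s]
      exact pexp_mem_Icc fun a => qHat_mem_Icc ⟨h, hlt⟩ _ s a
    · simp [hVH]
  have hle : ∀ h : ℕ, (M.H : ℝ) - h ≤ M.H := fun h => sub_le_self _ (Nat.cast_nonneg h)
  let Q : ℕ → S → A → ℝ := fun h s a =>
    if hh : h < M.H then qHat M φ 1 D β ⟨h, hh⟩ (V (h + 1)) s a else 0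
  have hQeq : ∀ (h : ℕ) (hh : h < M.H), Q h = qHat M φ 1 D β ⟨h, hh⟩ (V (h + 1)) := by
    intro h hh
    funext s a
    simp only [Q, dif_pos hh]
  have herr : ∀ h < M.H, ∀ x ∈ X h,
      |Q h x.1 x.2 - (M.r h x.1 x.2 + pexp (M.P h x.1 x.2) (V (h + 1)))| ≤
        (c h + Cw + β) / √(N h) := by
    intro h hh x hx
    rw [hQeq h hh]
    exact abs_qHat_sub_le hM hβ ⟨h, hh⟩ (hVb (h + 1) hh) (hc h)
      (fun hh' g => hη h hh' g _ fun s =>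
        ⟨(hVb (h + 1) hh s).1, (hVb (h + 1) hh s).2.trans (hle _)⟩)
      (hN h hh) (hvis ⟨h, hh⟩ x hx)
  refine subOpt_le_two_mul_sum (V := V) (Q := Q) (c := M.H) hopt
    (fun h hh s => ⟨(hVb h hh s).1, (hVb h hh s).2.trans (hle h)⟩) hVH (fun h hh s a => ?_)
    (fun h hh s => ?_) (fun h hh s hs => ?_) (fun h hh x hx => herr h hh x (hXs h hh hx))
    (fun h hh x hx => herr h hh x (hX h hh hx))
  · rw [hQeq h hh, abs_of_nonneg (qHat_mem_Icc _ _ _ _).1]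
    exact (qHat_mem_Icc _ _ _ _).2.trans (hle h)
  · rw [hQeq h hh]
    exact (hV ⟨h, hh⟩).2 s
  · rw [hQeq h hh, (hV ⟨h, hh⟩).2 s]
    exact (hV ⟨h, hh⟩).1.pexp_le (hB h hh s hs)

end Bellman

/-! ### The pairs covered by the data -/

section Coverage

variable {M : MDP S A} {μ : Collector M} {K : ℕ} {B : ℕ → S → Set A}

lemma support_pairOcc_subset {ρ ρ' : Policy S A}
    (h : ∀ i < M.H, ∀ s ∈ feasibleStates M i, (ρ i s).support ⊆ (ρ' i s).support) {i : ℕ}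
    (hi : i < M.H) : (pairOcc M ρ i).support ⊆ (pairOcc M ρ' i).support := by
  intro x hx
  rw [mem_support_pairOcc] at hx ⊢
  exact ⟨support_stateOcc_subset M (fun i hi s hs => h i hi s (mem_feasibleStates M hs)) hi.le hx.1,
    h i hi x.1 (mem_feasibleStates M hx.1) hx.2⟩

lemma kappaInv_le {n : ℕ} (hn : n < K) {D : Fin n → Traj M} (hD : D ∈ (dataLaw M μ n).support)
    {h : ℕ} {x : S × A} (hx : x ∈ (pairOcc M (μ n D) h).support) :
    kappaInv M μ K h ≤ (pairOcc M (μ n D) h x).toReal := by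
  rw [toReal_pairOcc]
  exact csInf_le ⟨0, fun y hy => hy.1.le⟩ ⟨(occ_pos_iff M).2 hx, n, hn, D, hD, x.1, x.2, rfl⟩

/-- `X h` is the set of state-action pairs that the data visit at stage `h`. -/
structure Covers (M : MDP S A) (μ : Collector M) (K : ℕ) (B : ℕ → S → Set A)
    (X : ℕ → Finset (S × A)) : Prop where
  nonempty : ∀ h < M.H, (X h).Nonempty
  card_le : ∀ h < M.H, ((X h).card : ℝ) ≤ (kappaInv M μ K h)⁻¹
  support_eq : ∀ n < K, ∀ D ∈ (dataLaw M μ n).support, ∀ h < M.H,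
    (pairOcc M (μ n D) h).support = X h
  support_subset : ∀ ρ : Policy S A,
    (∀ i < M.H, ∀ s ∈ feasibleStates M i, (ρ i s).support ⊆ B i s) →
      ∀ h < M.H, (pairOcc M ρ h).support ⊆ X h

lemma zero_mem_support_dataLaw : (Fin.elim0 : Fin 0 → Traj M) ∈ (dataLaw M μ 0).support := by
  simp [dataLaw]

/-- The first behaviour policy already determines the sets: the others have equal action supports on
feasible states, hence reach the same pairs, and the mass bound limits their number. -/
lemma exists_covers (hK : 1 ≤ K) (hB : HasSupport M μ K B) (hd : DensityLowerBound M μ K) :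
    ∃ X, Covers M μ K B X := by
  have h0 := zero_mem_support_dataLaw (μ := μ)
  have hB0 := hB 0 hK _ h0
  set π0 := μ 0 Fin.elim0 with hπ0
  have hfin : ∀ h < M.H, (pairOcc M π0 h).support.Finite ∧
      ((pairOcc M π0 h).support.ncard : ℝ) ≤ (kappaInv M μ K h)⁻¹ := fun h hh =>
    finite_support_of_le (hd h hh) fun x hx => kappaInv_le hK h0 hx
  have hex : ∀ h, ∃ T : Finset (S × A), h < M.H → (T : Set (S × A)) = (pairOcc M π0 h).support := by
    intro h
    by_cases hh : h < M.H
    · exact ⟨(hfin h hh).1.toFinset, fun _ => by simp⟩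
    · exact ⟨∅, fun h => absurd h hh⟩
  choose X hX using hex
  refine ⟨X, fun h hh => ?_, fun h hh => ?_, fun n hn D hD h hh => ?_, fun ρ hρ h hh => ?_⟩
  · rw [← Finset.coe_nonempty, hX h hh]
    exact PMF.support_nonempty _
  · rw [← Set.ncard_coe_finset, hX h hh]
    exact (hfin h hh).2
  · rw [hX h hh]
    refine subset_antisymm (support_pairOcc_subset (fun i hi s hs => ?_) hh)
      (support_pairOcc_subset (fun i hi s hs => ?_) hh) <;>
    rw [hB n hn D hD i hi s hs, hB0 i hi s hs]
  · rw [hX h hh]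
    exact support_pairOcc_subset (fun i hi s hs => (hρ i hi s hs).trans (hB0 i hi s hs).ge) hh

/-- The states of the pairs in `X h`. -/
noncomputable def states (X : ℕ → Finset (S × A)) (h : ℕ) : Finset S :=
  open Classical in (X h).image Prod.fst

lemma card_states_le (X : ℕ → Finset (S × A)) (h : ℕ) : (states X h).card ≤ (X h).card := by
  classical
  exact Finset.card_image_le

lemma mem_states {X : ℕ → Finset (S × A)} {h : ℕ} {x : S × A} (hx : x ∈ X h) :
    x.1 ∈ states X h := by
  classical
  exact Finset.mem_image_of_mem Prod.fst hx

variable {X : ℕ → Finset (S × A)}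

/-- The behaviour policy plays some action at every successor state, which puts that state into a
covered pair. So only finitely many next states matter for the indicators. -/
lemma Covers.support_step_subset (hX : Covers M μ K B X) (hK : 1 ≤ K) {h : ℕ} (hh : h + 1 < M.H)
    {x : S × A} (hx : x ∈ X h) : (step M h x).support ⊆ states X (h + 1) := by
  intro s hs
  have h0 := hX.support_eq 0 hK _ zero_mem_support_dataLaw
  rw [← Finset.mem_coe, ← h0 h (by omega)] at hx
  obtain ⟨a, ha⟩ := (μ 0 Fin.elim0 (h + 1) s).support_nonempty
  have : (s, a) ∈ X (h + 1) := by
    rw [← Finset.mem_coe, ← h0 (h + 1) hh]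
    exact (mem_support_pairOcc M).2 ⟨mem_support_stateOcc_succ M hx hs, ha⟩
  exact mem_states this

lemma Covers.mem_of_mem_support (hX : Covers M μ K B X) {n : ℕ} (hn : n ≤ K)
    {D : Fin n → Traj M} (hD : D ∈ (dataLaw M μ n).support) (t : Fin n) (h : Fin M.H) :
    D t h ∈ X h := by
  refine forall_of_mem_support_dataLaw μ (p := fun τ => ∀ h : Fin M.H, τ h ∈ X h)
    (fun n hn D hD τ hτ h => ?_) hn hD t h
  rw [← Finset.mem_coe, ← hX.support_eq n hn D hD h h.isLt]
  exact mem_support_pairOcc_of_trajLaw hτ h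

/-- The event on which the estimates computed from `D` are accurate. -/
def Good (μ : Collector M) (K : ℕ) (X : ℕ → Finset (S × A)) (δ : ℝ) {n : ℕ}
    (D : Fin n → Traj M) : Prop :=
  (∀ (h : ℕ) (hh : h + 1 < M.H) (c : X h → Fin (2 * K + 1)), ∀ E ⊆ states X (h + 1),
    ∑ t, (gridFun (X h) c (D t ⟨h, by omega⟩) * noise (step M h) ((E : Set S).indicator 1)
      (D t ⟨h, by omega⟩) (D t ⟨h + 1, hh⟩).1 - gridFun (X h) c (D t ⟨h, by omega⟩) ^ 2) ≤
    Real.log (((2 * K + 1) ^ (X h).card * 2 ^ (states X (h + 1)).card : ℕ) / δ)) ∧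
  ∀ (h : Fin M.H), ∀ x ∈ X h,
    n * (kappaInv M μ K h / 2) - (visits D h x).card ≤ Real.log ((X h).card / δ)

lemma Covers.toOuterMeasure_not_good_le (hX : Covers M μ K B X) {n : ℕ} (hn : n ≤ K) {δ : ℝ}
    (hδ : 0 < δ) :
    (dataLaw M μ n).toOuterMeasure {D | ¬ Good μ K X δ D} ≤ ENNReal.ofReal (2 * M.H * δ) := by
  let E1 : Fin M.H → Set (Fin n → Traj M) := fun h => {D | ∃ hh : (h : ℕ) + 1 < M.H,
    ∃ c : X h → Fin (2 * K + 1), ∃ E ⊆ states X (h + 1),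
      Real.log (((2 * K + 1) ^ (X h).card * 2 ^ (states X (h + 1)).card : ℕ) / δ) <
        ∑ t, (gridFun (X h) c (D t h) * noise (step M h) ((E : Set S).indicator 1)
          (D t h) (D t ⟨h + 1, hh⟩).1 - gridFun (X h) c (D t h) ^ 2)}
  let E2 : Fin M.H → Set (Fin n → Traj M) := fun h => {D | ∃ x ∈ X h,
    Real.log ((X h).card / δ) < n * (kappaInv M μ K h / 2) - (visits D h x).card}
  have hsub : {D : Fin n → Traj M | ¬ Good μ K X δ D} ⊆ ⋃ h, (E1 h ∪ E2 h) := by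
    intro D hD
    rw [Set.mem_ofPred_eq, Good, not_and_or] at hD
    push Not at hD
    rw [Set.mem_iUnion]
    rcases hD with ⟨h, hh, c, E, hE, hlt⟩ | ⟨h, x, hx, hlt⟩
    · exact ⟨⟨h, by omega⟩, Or.inl ⟨hh, c, E, hE, hlt⟩⟩
    · exact ⟨h, Or.inr ⟨x, hx, hlt⟩⟩
  have h1 : ∀ h, (dataLaw M μ n).toOuterMeasure (E1 h) ≤ ENNReal.ofReal δ := by
    intro h
    by_cases hh : (h : ℕ) + 1 < M.H
    · refine le_trans (MeasureTheory.measure_mono ?_)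
        (toOuterMeasure_noise_le h hh (X h) (states X (h + 1)) K hδ)
      rintro D ⟨_, c, E, hE, hlt⟩
      exact ⟨c, E, hE, hlt⟩
    · have : E1 h = ∅ := Set.eq_empty_of_forall_notMem fun D ⟨hh', _⟩ => hh hh'
      simp [this]
  have h2 : ∀ h, (dataLaw M μ n).toOuterMeasure (E2 h) ≤ ENNReal.ofReal δ := fun h =>
    toOuterMeasure_visits_le h (X h) (hX.nonempty h h.isLt)
      (fun n hn D hD x hx => kappaInv_le hn hD (by
        rw [hX.support_eq n hn D hD h h.isLt]; exact hx)) hn hδ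
  calc (dataLaw M μ n).toOuterMeasure {D | ¬ Good μ K X δ D}
      ≤ ∑ h, (dataLaw M μ n).toOuterMeasure (E1 h ∪ E2 h) :=
        (MeasureTheory.measure_mono hsub).trans (MeasureTheory.measure_iUnion_fintype_le _ _)
    _ ≤ ∑ _h : Fin M.H, ENNReal.ofReal (2 * δ) := by
        refine Finset.sum_le_sum fun h _ => (MeasureTheory.measure_union_le _ _).trans ?_
        rw [two_mul, ENNReal.ofReal_add hδ.le hδ.le]
        exact add_le_add (h1 h) (h2 h)
    _ = ENNReal.ofReal (2 * M.H * δ) := by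
        rw [Finset.sum_const, Finset.card_univ, Fintype.card_fin, nsmul_eq_mul,
          ← ENNReal.ofReal_natCast, ← ENNReal.ofReal_mul (Nat.cast_nonneg _)]
        congr 1
        ring

lemma Covers.prob_not_good_le (hX : Covers M μ K B X) (hH : 1 ≤ M.H) (hK : 1 ≤ K) :
    prob (dataLaw M μ K) {D | ∃ (n : ℕ) (hn : n ≤ K),
      ¬ Good μ K X (1 / (M.H * (K : ℝ) ^ 2)) (firstEpisodes D n hn)} ≤ 4 / K := by
  have hH' : (1 : ℝ) ≤ M.H := by exact_mod_cast hH
  have hK' : (1 : ℝ) ≤ K := by exact_mod_cast hK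
  set δ : ℝ := 1 / (M.H * (K : ℝ) ^ 2) with hδ
  have hδ0 : 0 < δ := by positivity
  refine ENNReal.toReal_le_of_le_ofReal (by positivity) ?_
  have hsub : {D : Fin K → Traj M | ∃ (n : ℕ) (hn : n ≤ K),
      ¬ Good μ K X δ (firstEpisodes D n hn)} ⊆
      ⋃ n : Fin (K + 1), {D | ¬ Good μ K X δ (firstEpisodes D n (Nat.lt_succ_iff.1 n.isLt))} := by
    rintro D ⟨n, hn, hD⟩
    exact Set.mem_iUnion.2 ⟨⟨n, Nat.lt_succ_iff.2 hn⟩, hD⟩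
  calc (dataLaw M μ K).toOuterMeasure _
      ≤ ∑ n : Fin (K + 1), (dataLaw M μ K).toOuterMeasure
          {D | ¬ Good μ K X δ (firstEpisodes D n (Nat.lt_succ_iff.1 n.isLt))} :=
        (MeasureTheory.measure_mono hsub).trans (MeasureTheory.measure_iUnion_fintype_le _ _)
    _ ≤ ∑ _n : Fin (K + 1), ENNReal.ofReal (2 * M.H * δ) := by
        refine Finset.sum_le_sum fun n _ => ?_
        rw [toOuterMeasure_eq_eexp]
        refine le_trans (le_of_eq ?_)
          (hX.toOuterMeasure_not_good_le (Nat.lt_succ_iff.1 n.isLt) hδ0)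
        rw [toOuterMeasure_eq_eexp, ← eexp_firstEpisodes μ (Nat.lt_succ_iff.1 n.isLt)]
        rfl
    _ ≤ ENNReal.ofReal (4 / K) := by
        rw [Finset.sum_const, Finset.card_univ, Fintype.card_fin, nsmul_eq_mul,
          ← ENNReal.ofReal_natCast, ← ENNReal.ofReal_mul (Nat.cast_nonneg _)]
        refine ENNReal.ofReal_le_ofReal ?_
        -- The level `1 / (H K ^ 2)` pays for two events per stage and for all `K + 1` prefixes,
        -- leaving order `1 / K`.
        have e : ((K + 1 : ℕ) : ℝ) * (2 * M.H * δ) = (2 * (K + 1)) / (K * K) := by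
          rw [hδ]; push_cast; field_simp
        rw [e, div_le_div_iff₀ (by positivity) (by positivity)]
        nlinarith

end Coverage

/-! ### Rates -/

section Rates

/-- The visit count costs `√k` and the uniform noise bound `√(k + k')`; their product is at most `k
+ k'`, which keeps the final rate linear in `κ`. The weight `7 = 5 + 2` combines the noise with the
`Cw + β` part. -/
lemma stage_error_le {n l H d Cw k k' β : ℝ} (hn : 0 < n) (hl : 1 ≤ l) (hH : 1 ≤ H) (hd : 1 ≤ d)
    (hCw : 0 ≤ Cw) (hk : 1 ≤ k) (hk' : 0 ≤ k') (hβ : β ≤ 2 * H * d * l + Cw) :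
    (H * √(24 * l * (k + k')) + Cw + β) / √(n * (k⁻¹ / 4)) ≤
      2 / √n * (H * d * l * (1 + Cw)) * (7 * k + 5 * k') := by
  have hk0 : 0 < k := by linarith
  have hsk : √k ≤ k := Real.sqrt_le_iff.2 ⟨hk0.le, by nlinarith⟩
  have hs : √(n * (k⁻¹ / 4)) = √n / (2 * √k) := by
    rw [Real.sqrt_mul hn.le, Real.sqrt_div (inv_nonneg.2 hk0.le), Real.sqrt_inv,
      show (4 : ℝ) = 2 ^ 2 by norm_num, Real.sqrt_sq (by norm_num)]
    have := Real.sqrt_pos.2 hk0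
    field_simp
  have h1 : √k * √(24 * l * (k + k')) ≤ 5 * l * (k + k') := by
    rw [← Real.sqrt_mul hk0.le]
    refine Real.sqrt_le_iff.2 ⟨by positivity, ?_⟩
    have h2 : k * l ≤ (k + k') * (l * l) := by
      have : l ≤ l * l := by nlinarith
      exact mul_le_mul (by linarith) this (by linarith) (by linarith)
    have h3 : 0 ≤ k + k' := by linarith
    nlinarith [mul_le_mul_of_nonneg_right h2 h3, mul_nonneg h3 (mul_nonneg h3 (mul_self_nonneg l))]
  have hHdl : 1 ≤ H * d * l := one_le_mul_of_one_le_of_one_le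
    (one_le_mul_of_one_le_of_one_le hH hd) hl
  have h4 : √k * (H * √(24 * l * (k + k')) + Cw + β) ≤
      (H * d * l * (1 + Cw)) * (7 * k + 5 * k') := by
    have h5 : H * (√k * √(24 * l * (k + k'))) ≤ (H * d * l * (1 + Cw)) * (5 * (k + k')) := by
      calc H * (√k * √(24 * l * (k + k'))) ≤ H * (5 * l * (k + k')) := by gcongr
        _ = (H * 1 * l * 1) * (5 * (k + k')) := by ring
        _ ≤ (H * d * l * (1 + Cw)) * (5 * (k + k')) := by
            gcongr
            linarith
    have h6 : √k * (Cw + β) ≤ k * (2 * (H * d * l * (1 + Cw))) := by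
      have h7 : Cw + β ≤ 2 * (H * d * l * (1 + Cw)) := by nlinarith
      calc √k * (Cw + β) ≤ √k * (2 * (H * d * l * (1 + Cw))) := by gcongr
        _ ≤ _ := by gcongr
    nlinarith
  rw [hs, div_div_eq_mul_div, mul_comm _ (2 * √k), mul_assoc 2, div_mul_eq_mul_div,
    div_mul_eq_mul_div, mul_assoc 2]
  gcongr

/-- Each term is at most the increment `2 (√(k + 1) - √k)`, so the sum telescopes. -/
lemma sum_inv_sqrt_le (K : ℕ) : ∑ k : Fin K, 1 / √((k : ℝ) + 1) ≤ 2 * √K := by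
  induction K with
  | zero => simp
  | succ K ih =>
    rw [Fin.sum_univ_castSucc]
    simp only [Fin.val_castSucc, Fin.val_last]
    refine (add_le_add ih le_rfl).trans ?_
    push_cast
    have h1 : 0 < √((K : ℝ) + 1) := Real.sqrt_pos.2 (by positivity)
    have h2 := Real.sq_sqrt (show (0 : ℝ) ≤ K + 1 by positivity)
    have h3 := Real.sq_sqrt (show (0 : ℝ) ≤ K by positivity)
    have h4 : 1 / √((K : ℝ) + 1) ≤ 2 * (√((K : ℝ) + 1) - √K) := by
      rw [div_le_iff₀ h1]
      nlinarith [sq_nonneg (√((K : ℝ) + 1) - √K)]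
    linarith

variable {d H K : ℕ}

/-- The logarithmic factor. -/
noncomputable def logFactor (d H K : ℕ) : ℝ := 1 + Real.log (d * H * K)

lemma logFactor_eq (hd : 1 ≤ d) (hH : 1 ≤ H) (hK : 1 ≤ K) :
    logFactor d H K = 1 + Real.log d + Real.log H + Real.log K := by
  rw [logFactor, Real.log_mul (by positivity) (by positivity),
    Real.log_mul (by positivity) (by positivity)]
  ring

lemma log_three_le : Real.log 3 ≤ 2 := by
  have := Real.log_le_sub_one_of_pos (show (0 : ℝ) < 3 by norm_num)
  linarith

lemma betaVTR_le {n : ℕ} {Cw : ℝ} (hd : 1 ≤ d) (hH : 1 ≤ H) (hK : 1 ≤ K) (hn : n ≤ K) :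
    betaVTR d H 1 Cw (1 / K) (n + 1) ≤ 2 * H * d * logFactor d H K + Cw := by
  have hd' : (1 : ℝ) ≤ d := by exact_mod_cast hd
  have hH' : (1 : ℝ) ≤ H := by exact_mod_cast hH
  have hK' : (1 : ℝ) ≤ K := by exact_mod_cast hK
  have hn' : (n : ℝ) ≤ K := by exact_mod_cast hn
  have hld := Real.log_nonneg hd'
  have hlH := Real.log_nonneg hH'
  have hlK := Real.log_nonneg hK'
  set l := logFactor d H K with hl
  have hleq := logFactor_eq hd hH hK
  have hl1 : 1 ≤ l := by linarith
  rw [betaVTR, Real.sqrt_one, one_mul]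
  have hlog : Real.log ((H + ((n + 1 : ℕ) : ℝ) * (H : ℝ) ^ 3 / 1) / (1 / K)) ≤ 3 * l := by
    have h1 : (H + ((n + 1 : ℕ) : ℝ) * (H : ℝ) ^ 3 / 1) / (1 / K) ≤
        3 * (K : ℝ) ^ 2 * (H : ℝ) ^ 3 := by
      push_cast
      rw [div_one, div_div_eq_mul_div, div_one]
      have h2 : (H : ℝ) ≤ (H : ℝ) ^ 3 := le_self_pow₀ hH' (by norm_num)
      have h3 : (H : ℝ) + ((n : ℝ) + 1) * (H : ℝ) ^ 3 ≤ 3 * K * (H : ℝ) ^ 3 := by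
        have : ((n : ℝ) + 2) * (H : ℝ) ^ 3 ≤ 3 * K * (H : ℝ) ^ 3 := by
          gcongr
          linarith
        linarith
      calc _ ≤ 3 * K * (H : ℝ) ^ 3 * K := by gcongr
        _ = _ := by ring
    refine (Real.log_le_log (by positivity) h1).trans ?_
    rw [Real.log_mul (by positivity) (by positivity), Real.log_mul (by positivity) (by positivity),
      Real.log_pow, Real.log_pow]
    push_cast
    linarith [log_three_le]
  have hsqrt : √(d * Real.log ((H + ((n + 1 : ℕ) : ℝ) * (H : ℝ) ^ 3 / 1) / (1 / K))) ≤
      2 * (d * l) := by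
    have hdl : 1 ≤ d * l := one_le_mul_of_one_le_of_one_le hd' hl1
    refine Real.sqrt_le_iff.2 ⟨by positivity, ?_⟩
    have : d * Real.log ((H + ((n + 1 : ℕ) : ℝ) * (H : ℝ) ^ 3 / 1) / (1 / K)) ≤ d * (3 * l) := by
      gcongr
    nlinarith
  have := mul_le_mul_of_nonneg_left hsqrt (show (0 : ℝ) ≤ H by positivity)
  linarith

/-- The logarithm of the number of test functions over the confidence level. -/
lemma log_card_le {x y : ℕ} {k k' : ℝ} (hd : 1 ≤ d) (hH : 1 ≤ H) (hK : 1 ≤ K) (hk : 1 ≤ k)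
    (hx : (x : ℝ) ≤ k) (hy : (y : ℝ) ≤ k') :
    4 * (Real.log (((2 * K + 1) ^ x * 2 ^ y : ℕ) / (1 / (H * (K : ℝ) ^ 2))) + 1) ≤
      24 * logFactor d H K * (k + k') := by
  have hd' : (1 : ℝ) ≤ d := by exact_mod_cast hd
  have hH' : (1 : ℝ) ≤ H := by exact_mod_cast hH
  have hK' : (1 : ℝ) ≤ K := by exact_mod_cast hK
  have hld := Real.log_nonneg hd'
  have hlH := Real.log_nonneg hH'
  have hlK := Real.log_nonneg hK'
  have hleq := logFactor_eq hd hH hK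
  set l := logFactor d H K with hl
  have hl1 : 1 ≤ l := by linarith
  have hk'0 : 0 ≤ k' := (Nat.cast_nonneg y).trans hy
  push_cast
  rw [div_div_eq_mul_div, div_one, Real.log_mul (by positivity) (by positivity),
    Real.log_mul (by positivity) (by positivity), Real.log_mul (by positivity) (by positivity),
    Real.log_pow, Real.log_pow, Real.log_pow]
  have h1 : Real.log (2 * K + 1) ≤ 2 * l := by
    have h2 : Real.log (2 * K + 1) ≤ Real.log (3 * K) :=
      Real.log_le_log (by positivity) (by linarith)
    rw [Real.log_mul (by norm_num) (by positivity)] at h2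
    linarith [log_three_le]
  have h2 : Real.log 2 ≤ l := by
    have := Real.log_le_sub_one_of_pos (show (0 : ℝ) < 2 by norm_num)
    linarith
  have h3 : (x : ℝ) * Real.log (2 * K + 1) ≤ k * (2 * l) :=
    mul_le_mul hx h1 (Real.log_nonneg (by linarith)) (by linarith)
  have h4 : (y : ℝ) * Real.log 2 ≤ k' * l :=
    mul_le_mul hy h2 (Real.log_nonneg (by norm_num)) hk'0
  have h5 : l ≤ k * l := le_mul_of_one_le_left (by linarith) hk
  have h6 : 0 ≤ k' * l := by positivity
  push_cast
  nlinarith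

lemma log_visits_le {x : ℕ} (hd : 1 ≤ d) (hH : 1 ≤ H) (hK : 1 ≤ K) (hx0 : 0 < x)
    (hx : (x : ℝ) ≤ K) :
    Real.log (x / (1 / (H * (K : ℝ) ^ 2))) ≤ 3 * logFactor d H K := by
  have hd' : (1 : ℝ) ≤ d := by exact_mod_cast hd
  have hH' : (1 : ℝ) ≤ H := by exact_mod_cast hH
  have hK' : (1 : ℝ) ≤ K := by exact_mod_cast hK
  have hx0' : (0 : ℝ) < x := by exact_mod_cast hx0
  have hld := Real.log_nonneg hd'
  have hlH := Real.log_nonneg hH'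
  have hlK := Real.log_nonneg hK'
  have hlx := Real.log_le_log hx0' hx
  rw [logFactor_eq hd hH hK, div_div_eq_mul_div, div_one, Real.log_mul hx0'.ne' (by positivity),
    Real.log_mul (by positivity) (by positivity), Real.log_pow]
  push_cast
  linarith

end Rates

/-! ### The main estimates -/

section Main

variable {M : MDP S A} {μ : Collector M} {K d : ℕ} {B : ℕ → S → Set A}
  {φ : S → A → S → EuclideanSpace ℝ (Fin d)} {Cw : ℝ} {X : ℕ → Finset (S × A)}

lemma IsLinearMixture.Cw_nonneg (hM : IsLinearMixture M φ Cw) (hH : 1 ≤ M.H) : 0 ≤ Cw := by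
  obtain ⟨w, hw⟩ := hM.transition
  exact (norm_nonneg _).trans (hw 0 hH).1

/-- In dimension zero all transition probabilities would vanish, yet they sum to one. -/
lemma IsLinearMixture.one_le_dim (hM : IsLinearMixture M φ Cw) (hH : 1 ≤ M.H) (s : S) (a : A) :
    1 ≤ d := by
  obtain ⟨w, hw⟩ := hM.transition
  by_contra hd
  obtain rfl : d = 0 := by omega
  have h1 := tsum_toReal (M.P 0 s a)
  simp only [(hw 0 hH).2, Subsingleton.elim (w 0) 0, inner_zero_right, tsum_zero] at h1
  exact zero_ne_one h1

lemma Covers.one_le (hX : Covers M μ K B X) {h : ℕ} (hh : h < M.H) :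
    1 ≤ (kappaInv M μ K h)⁻¹ := by
  refine le_trans ?_ (hX.card_le h hh)
  exact_mod_cast (hX.nonempty h hh).card_pos

lemma Covers.le_kappa (hX : Covers M μ K B X) {h : ℕ} (hh : h < M.H) :
    (kappaInv M μ K h)⁻¹ ≤ kappa M μ K :=
  Finset.single_le_sum (f := fun h => (kappaInv M μ K h)⁻¹)
    (fun _ hi => zero_le_one.trans (hX.one_le (Finset.mem_range.1 hi))) (Finset.mem_range.2 hh)

/-- The rate without the factor `1 / √K`. -/
noncomputable def rate (M : MDP S A) (μ : Collector M) (K d : ℕ) (Cw : ℝ) : ℝ :=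
  kappa M μ K * M.H * d * (1 + Cw) * logFactor d M.H K

lemma subOpt_le_of_good (hX : Covers M μ K B X) (hH : 1 ≤ M.H) (hK : 1 ≤ K) (hd : 1 ≤ d)
    (hM : IsLinearMixture M φ Cw) (hB : HasSupport M μ K B) (hopc : OPC M μ K)
    (hκ : kappa M μ K ≤ √K) {n : ℕ} (hn : n ≤ K) {D : Fin n → Traj M}
    (hD : D ∈ (dataLaw M μ n).support) {π : Policy S A}
    (hπ : IsIterate M φ 1 D B (betaVTR d M.H 1 Cw (1 / K) (n + 1)) π)
    (hgood : Good μ K X (1 / (M.H * (K : ℝ) ^ 2)) D) :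
    subOpt M π ≤ 96 * rate M μ K d Cw / √((n : ℝ) + 1) := by
  have hd' : (1 : ℝ) ≤ d := by exact_mod_cast hd
  have hH' : (1 : ℝ) ≤ M.H := by exact_mod_cast hH
  have hK' : (1 : ℝ) ≤ K := by exact_mod_cast hK
  have hCw := hM.Cw_nonneg hH
  have hl1 : 1 ≤ logFactor d M.H K := by
    rw [logFactor_eq hd hH hK]
    linarith [Real.log_nonneg hd', Real.log_nonneg hH', Real.log_nonneg hK']
  have hκ1 : 1 ≤ kappa M μ K := (hX.one_le hH).trans (hX.le_kappa hH)
  have hs0 : 0 < √((n : ℝ) + 1) := Real.sqrt_pos.2 (by positivity)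
  rw [rate]
  set l := logFactor d M.H K with hl
  set κ := kappa M μ K with hκdef
  -- With few episodes, `n = 0` included, visit counts are not yet guaranteed, but the trivial bound
  -- `H` is below the claimed rate.
  rcases lt_or_ge (n : ℝ) (12 * κ * l) with hlt | hge
  · refine (subOpt_mem_Icc M π).2.trans ((le_div_iff₀ hs0).2 ?_)
    have h1 : √((n : ℝ) + 1) ≤ 13 * (κ * l) := by
      have h2 : √((n : ℝ) + 1) ≤ (n : ℝ) + 1 :=
        Real.sqrt_le_iff.2 ⟨by positivity, by nlinarith [show (0 : ℝ) ≤ n from Nat.cast_nonneg n]⟩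
      have h3 : 1 ≤ κ * l := one_le_mul_of_one_le_of_one_le hκ1 hl1
      linarith
    calc (M.H : ℝ) * √((n : ℝ) + 1) ≤ M.H * (96 * (κ * l)) := by
          gcongr
          exact h1.trans (by nlinarith [show 0 ≤ κ * l by positivity])
      _ = 96 * (κ * M.H * 1 * 1 * l) := by ring
      _ ≤ 96 * (κ * M.H * d * (1 + Cw) * l) := by
          gcongr
          linarith
  have hn1 : (1 : ℝ) ≤ n := by
    have : 1 ≤ κ * l := one_le_mul_of_one_le_of_one_le hκ1 hl1
    linarith
  have hn0 : (0 : ℝ) < n := by linarith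
  obtain ⟨πs, hopt, hcov⟩ := hopc
  have hocc : ∀ h < M.H, ∀ x ∈ (pairOcc M πs h).support,
      x ∈ (pairOcc M (μ 0 Fin.elim0) h).support := fun h hh x hx =>
    (occ_pos_iff M).1 (hcov 0 hK _ zero_mem_support_dataLaw h hh x.1 x.2 ((occ_pos_iff M).2 hx))
  have h0 := hX.support_eq 0 hK _ zero_mem_support_dataLaw
  let k : ℕ → ℝ := fun h => (kappaInv M μ K h)⁻¹
  -- `k'` bounds the number of next states. It is zero past the horizon, so its sum over stages is
  -- again at most `κ`.
  let k' : ℕ → ℝ := fun h => if h + 1 < M.H then (kappaInv M μ K (h + 1))⁻¹ else 0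
  have hk1 : ∀ h < M.H, 1 ≤ k h := fun h hh => hX.one_le hh
  have hkpos : ∀ h < M.H, 0 < kappaInv M μ K h := fun h hh =>
    inv_pos.1 (zero_lt_one.trans_le (hk1 h hh))
  have hk'0 : ∀ h, 0 ≤ k' h := by
    intro h
    simp only [k']
    split_ifs with hh
    · exact zero_le_one.trans (hX.one_le hh)
    · exact le_rfl
  have hβ0 : 0 ≤ betaVTR d M.H 1 Cw (1 / K) (n + 1) := by
    rw [betaVTR]; positivity
  have key := hπ.subOpt_le (πs := πs) (X := fun h => X h)
    (c := fun h => M.H * √(24 * l * (k h + k' h))) (N := fun h => n * ((k h)⁻¹ / 4))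
    hM hβ0 hopt ?_ ?_ ?_ (fun h => by positivity) ?_ ?_ ?_
  · calc subOpt M π
        ≤ 2 * ∑ h ∈ Finset.range M.H,
            2 / √(n : ℝ) * (M.H * d * l * (1 + Cw)) * (7 * k h + 5 * k' h) := by
          refine key.trans ?_
          gcongr with h hh
          exact stage_error_le hn0 hl1 hH' hd' hCw (hk1 h (Finset.mem_range.1 hh)) (hk'0 h)
            (betaVTR_le hd hH hK hn)
      _ = 2 * (2 / √(n : ℝ) * (M.H * d * l * (1 + Cw)) * (7 * (∑ h ∈ Finset.range M.H, k h) +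
            5 * ∑ h ∈ Finset.range M.H, k' h)) := by
          rw [← Finset.mul_sum, Finset.sum_add_distrib, ← Finset.mul_sum, ← Finset.mul_sum]
      _ ≤ 2 * (2 / √(n : ℝ) * (M.H * d * l * (1 + Cw)) * (12 * κ)) := by
          have h1 : ∑ h ∈ Finset.range M.H, k h = κ := rfl
          have h2 : ∑ h ∈ Finset.range M.H, k' h ≤ κ := by
            rw [← h1, ← Nat.sub_add_cancel hH, Finset.sum_range_succ,
              Finset.sum_range_succ' k]
            refine add_le_add (Finset.sum_le_sum fun h hh => ?_) ?_
            · have := Finset.mem_range.1 hh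
              simp only [k', k]
              rw [if_pos (by omega)]
            · simp only [k']
              rw [if_neg (by omega)]
              exact zero_le_one.trans (hk1 0 hH)
          gcongr
          linarith
      _ = 48 * (κ * M.H * d * (1 + Cw) * l) / √(n : ℝ) := by ring
      _ ≤ 96 * (κ * M.H * d * (1 + Cw) * l) / √((n : ℝ) + 1) := by
          have hsn : √((n : ℝ) + 1) ≤ 2 * √(n : ℝ) := by
            rw [show (2 : ℝ) = √(2 ^ 2) by rw [Real.sqrt_sq (by norm_num)],
              ← Real.sqrt_mul (by norm_num)]
            exact Real.sqrt_le_sqrt (by linarith)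
          rw [div_le_div_iff₀ (Real.sqrt_pos.2 hn0) hs0]
          have : 0 ≤ κ * M.H * d * (1 + Cw) * l := by positivity
          nlinarith [mul_le_mul_of_nonneg_left hsn this]
  · intro h hh s hs a ha
    have hx := hocc h hh (s, a) ((mem_support_pairOcc M).2 ⟨hs, ha⟩)
    rw [mem_support_pairOcc] at hx
    rw [← hB 0 hK _ zero_mem_support_dataLaw h hh s (mem_feasibleStates M hs)]
    exact hx.2
  · intro h hh x hx
    rw [← h0 h hh]
    exact hocc h hh x hx
  · refine hX.support_subset π fun i hi s hs => ?_
    obtain ⟨V, -, hV⟩ := hπ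
    exact (hV ⟨i, hi⟩).1.1 s hs
  · intro h hh
    have := zero_lt_one.trans_le (hk1 h hh)
    positivity
  · intro h hh g V hV
    have hmem := hX.mem_of_mem_support hn hD
    refine (abs_sum_noise_le (X h) (states X (h + 1)) (step M h)
      (fun x hx => hX.support_step_subset hK hh hx) hK hn _ (fun t => hmem t ⟨h, by omega⟩) _
      (fun t => mem_states (hmem t ⟨h + 1, hh⟩)) (hgood.1 h hh) g (Nat.cast_nonneg _) hV).trans ?_
    refine mul_le_mul_of_nonneg_right (mul_le_mul_of_nonneg_left (Real.sqrt_le_sqrt ?_)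
      (Nat.cast_nonneg _)) (Real.sqrt_nonneg _)
    refine log_card_le hd hH hK (hk1 h (by omega)) (hX.card_le h (by omega)) ?_
    simp only [k']
    rw [if_pos hh]
    exact le_trans (by exact_mod_cast card_states_le X (h + 1)) (hX.card_le (h + 1) hh)
  · intro h x hx
    have h1 := hgood.2 h x hx
    have hkκ : k h ≤ κ := hX.le_kappa h.isLt
    -- The assumption `κ ≤ √K` is used only here, to keep `κ` out of the logarithmic factor.
    have hcardK : ((X h).card : ℝ) ≤ K := by
      refine (hX.card_le h h.isLt).trans (hkκ.trans (hκ.trans ?_))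
      exact Real.sqrt_le_iff.2 ⟨by positivity, by nlinarith⟩
    have h2 := log_visits_le hd hH hK (hX.nonempty h h.isLt).card_pos hcardK
    have hkp := hkpos h h.isLt
    -- The threshold `12 κ l` lets the deviation `3 l` consume at most half of the guaranteed `n /
    -- (2 κ_h)` visits, leaving `n / (4 κ_h)`.
    have h3 : 3 * l ≤ n * (kappaInv M μ K h / 4) := by
      have h4 : 12 * l * k h ≤ n := by
        refine le_trans ?_ hge
        nlinarith
      have h5 : k h * kappaInv M μ K h = 1 := inv_mul_cancel₀ hkp.ne'
      nlinarith [mul_le_mul_of_nonneg_right h4 hkp.le]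
    simp only [k, inv_inv]
    linarith

end Main

/-! ### Averaging over the iterates -/

section Final

variable {M : MDP S A} {K : ℕ}

lemma subOptMix_mem_Icc (π : (n : ℕ) → (Fin n → Traj M) → Policy S A) (D : Fin K → Traj M) :
    0 ≤ subOptMix M π D ∧ subOptMix M π D ≤ M.H := by
  have h := fun k : Fin K => subOpt_mem_Icc M (π k (firstEpisodes D k k.isLt.le))
  refine ⟨div_nonneg (Finset.sum_nonneg fun k _ => (h k).1) (Nat.cast_nonneg _), ?_⟩
  refine div_le_of_le_mul₀ (Nat.cast_nonneg _) (Nat.cast_nonneg _) ?_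
  refine (Finset.sum_le_sum fun k _ => (h k).2).trans ?_
  simp [mul_comm]

lemma subOptMix_le {π : (n : ℕ) → (Fin n → Traj M) → Policy S A} {D : Fin K → Traj M} {c : ℝ}
    (hK : 1 ≤ K) (hc : 0 ≤ c)
    (h : ∀ (n : ℕ) (hn : n ≤ K), subOpt M (π n (firstEpisodes D n hn)) ≤ c / √((n : ℝ) + 1)) :
    subOptMix M π D ≤ 2 * c / √K := by
  have hK' : (0 : ℝ) < K := by exact_mod_cast hK
  have hs := Real.sqrt_pos.2 hK'
  rw [subOptMix, div_le_iff₀ hK']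
  calc ∑ k : Fin K, subOpt M (π k (firstEpisodes D k k.isLt.le))
      ≤ ∑ k : Fin K, c * (1 / √((k : ℝ) + 1)) :=
        Finset.sum_le_sum fun k _ => (h k k.isLt.le).trans_eq (div_eq_mul_one_div _ _)
    _ = c * ∑ k : Fin K, 1 / √((k : ℝ) + 1) := by rw [Finset.mul_sum]
    _ ≤ c * (2 * √K) := mul_le_mul_of_nonneg_left (sum_inv_sqrt_le K) hc
    _ = 2 * c / √K * K := by
        nth_rewrite 3 [← Real.mul_self_sqrt hK'.le]
        field_simp

end Final

end OfflineRL

theorem mainTheorem8 :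
    ∃ (C : ℝ) (p : ℕ), 0 < C ∧
      ∀ (S : Type*) (A : Type*) (M : OfflineRL.MDP S A) (d : ℕ)
        (φ : S → A → S → EuclideanSpace ℝ (Fin d)) (Cw : ℝ) (K : ℕ)
        (μ : OfflineRL.Collector M) (B : ℕ → S → Set A)
        (π : (n : ℕ) → (Fin n → OfflineRL.Traj M) → OfflineRL.Policy S A),
        1 ≤ M.H → 1 ≤ K →
        OfflineRL.IsLinearMixture M φ Cw →
        OfflineRL.HasSupport M μ K B →
        OfflineRL.OPC M μ K →
        OfflineRL.DensityLowerBound M μ K →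
        OfflineRL.IsEnsemble M φ μ K B 1 Cw (1 / K) π →
        ∀ bound : ℝ,
          bound = C * (1 + Cw) * (OfflineRL.kappa M μ K * M.H * d / √K) *
            (1 + Real.log (d * M.H * K)) ^ p →
          1 - C / K ≤ OfflineRL.prob (OfflineRL.dataLaw M μ K)
              {D | max (OfflineRL.subOptMix M π D) (OfflineRL.subOptLast M π D) ≤ bound} ∧
            max (OfflineRL.pexp (OfflineRL.dataLaw M μ K) (OfflineRL.subOptMix M π))
              (OfflineRL.pexp (OfflineRL.dataLaw M μ K) (OfflineRL.subOptLast M π)) ≤ bound := by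
  open OfflineRL in
  -- The constant covers `2 * 96` from the mixture average plus `4` from the failure event in
  -- expectation.
  refine ⟨200, 1, by norm_num, ?_⟩
  intro S A M d φ Cw K μ B π hH hK hM hB hopc hdens hens bound hbound
  obtain ⟨X, hX⟩ := exists_covers hK hB hdens
  obtain ⟨s, hs⟩ := M.init.support_nonempty
  obtain ⟨a, ha⟩ := (μ 0 Fin.elim0 0 s).support_nonempty
  have hd : 1 ≤ d := hM.one_le_dim hH s a
  have hd' : (1 : ℝ) ≤ d := by exact_mod_cast hd
  have hH' : (1 : ℝ) ≤ M.H := by exact_mod_cast hH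
  have hK' : (1 : ℝ) ≤ K := by exact_mod_cast hK
  have hCw := hM.Cw_nonneg hH
  have hκ1 : 1 ≤ kappa M μ K := (hX.one_le hH).trans (hX.le_kappa hH)
  have hl1 : 1 ≤ logFactor d M.H K := by
    rw [logFactor_eq hd hH hK]
    linarith [Real.log_nonneg hd', Real.log_nonneg hH', Real.log_nonneg hK']
  have hsK : 0 < √(K : ℝ) := Real.sqrt_pos.2 (by linarith)
  have hsK2 : √(K : ℝ) ≤ K := Real.sqrt_le_iff.2 ⟨by positivity, by nlinarith⟩
  have hb : bound = 200 * rate M μ K d Cw / √K := by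
    rw [hbound, rate, logFactor, pow_one]
    ring
  have hrate : kappa M μ K * M.H ≤ rate M μ K d Cw := by
    rw [rate]
    have h1 : 1 ≤ (d : ℝ) * (1 + Cw) * logFactor d M.H K :=
      one_le_mul_of_one_le_of_one_le (one_le_mul_of_one_le_of_one_le hd' (by linarith)) hl1
    calc kappa M μ K * M.H ≤ kappa M μ K * M.H * (d * (1 + Cw) * logFactor d M.H K) :=
          le_mul_of_one_le_right (by positivity) h1
      _ = _ := by ring
  have hrateH : (M.H : ℝ) ≤ rate M μ K d Cw :=
    (le_mul_of_one_le_left (by linarith) hκ1).trans hrate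
  have hmixb := subOptMix_mem_Icc (K := K) π
  have hlastb : ∀ D : Fin K → Traj M, 0 ≤ subOptLast M π D ∧ subOptLast M π D ≤ M.H :=
    fun D => subOpt_mem_Icc M (π K D)
  -- One exceptional event serves both claims: `ε` bounds the sub-optimality off `E`, and the slack
  -- `H * (4 / K)` pays for `E` in expectation. If `κ > √K`, then `E` is empty and `ε = H`.
  obtain ⟨E, ε, hE, hε0, hεb, hgood⟩ : ∃ (E : Set (Fin K → Traj M)) (ε : ℝ),
      prob (dataLaw M μ K) E ≤ 4 / K ∧ 0 ≤ ε ∧ ε + M.H * (4 / K) ≤ bound ∧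
      ∀ D ∈ (dataLaw M μ K).support, D ∉ E → subOptMix M π D ≤ ε ∧ subOptLast M π D ≤ ε := by
    have hHK : M.H * (4 / (K : ℝ)) ≤ 4 * rate M μ K d Cw / √K := by
      rw [mul_div_assoc', mul_comm (M.H : ℝ)]
      have : 0 ≤ 4 * rate M μ K d Cw := by linarith
      gcongr
    rcases lt_or_ge √(K : ℝ) (kappa M μ K) with hκ | hκ
    · refine ⟨∅, M.H, ?_, by positivity, ?_, fun D _ _ => ⟨(hmixb D).2, (hlastb D).2⟩⟩
      · simp only [prob, MeasureTheory.measure_empty, ENNReal.toReal_zero]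
        positivity
      · have h1 : (M.H : ℝ) ≤ rate M μ K d Cw / √K := by
          rw [le_div_iff₀ hsK, mul_comm]
          exact (mul_le_mul_of_nonneg_right hκ.le (by linarith)).trans hrate
        rw [hb, mul_div_assoc]
        rw [mul_div_assoc] at hHK
        linarith
    · have h0 : 0 ≤ rate M μ K d Cw / √K := div_nonneg (by linarith) hsK.le
      refine ⟨_, 2 * (96 * rate M μ K d Cw) / √K, hX.prob_not_good_le hH hK,
        div_nonneg (by linarith) hsK.le, ?_, fun D hD hDE => ?_⟩
      · rw [hb, mul_div_assoc]
        rw [mul_div_assoc] at hHK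
        rw [mul_div_assoc, mul_div_assoc]
        linarith
      · have hDE' : ∀ (n : ℕ) (hn : n ≤ K),
            Good μ K X (1 / (M.H * (K : ℝ) ^ 2)) (firstEpisodes D n hn) := by
          intro n hn
          by_contra hcon
          exact hDE ⟨n, hn, hcon⟩
        have hsub : ∀ (n : ℕ) (hn : n ≤ K), subOpt M (π n (firstEpisodes D n hn)) ≤
            96 * rate M μ K d Cw / √((n : ℝ) + 1) := fun n hn =>
          have hmem := firstEpisodes_mem_support μ hn hD
          subOpt_le_of_good hX hH hK hd hM hB hopc hκ hn hmem (hens n hn _ hmem) (hDE' n hn)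
        refine ⟨subOptMix_le hK (by linarith) hsub, (hsub K le_rfl).trans ?_⟩
        calc 96 * rate M μ K d Cw / √((K : ℝ) + 1) ≤ 96 * rate M μ K d Cw / √K := by
              gcongr
              · linarith
              · linarith
          _ ≤ 2 * (96 * rate M μ K d Cw) / √K :=
              div_le_div_of_nonneg_right (by linarith) hsK.le
  have hεb' : ε ≤ bound := le_trans (le_add_of_nonneg_right (by positivity)) hεb
  constructor
  · have h1 := one_le_prob_add (p := dataLaw M μ K) (E := E)
      (F := {D | max (subOptMix M π D) (subOptLast M π D) ≤ bound}) fun D hD => by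
        by_cases hDE : D ∈ E
        · exact Or.inl hDE
        · obtain ⟨h1, h2⟩ := hgood D hD hDE
          exact Or.inr (max_le (h1.trans hεb') (h2.trans hεb'))
    have h2 : (4 : ℝ) / K ≤ 200 / K := by gcongr; norm_num
    linarith
  · have hfin : ∀ f : (Fin K → Traj M) → ℝ, (∀ D, 0 ≤ f D ∧ f D ≤ M.H) →
        (∀ D ∈ (dataLaw M μ K).support, D ∉ E → f D ≤ ε) → pexp (dataLaw M μ K) f ≤ bound := by
      intro f hf hfE
      refine (pexp_le_add_prob hε0 hf hfE).trans (le_trans ?_ hεb)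
      gcongr
    exact max_le (hfin _ hmixb fun D hD hDE => (hgood D hD hDE).1)
      (hfin _ hlastb fun D hD hDE => (hgood D hD hDE).2)
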